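/- **Setting.** Let $f:\mathbb R^d\to\mathbb R$ be twice differentiable with $\ell$-Lipschitz gradient and $\rho$-Lipschitz Hessian (in spectral norm), and bounded below with infimum $f^\star$; let $\ell,\rho,\epsilon,\delta,\Delta_f>0$, $\epsilon\le \ell^2/\rho$, $x_0\in\mathbb R^d$, $\Delta_f\ge f(x_0)-f^\star$. For real $\chi,c\ge 1$ put $$\kappa=\frac{\ell}{\sqrt{\rho\epsilon}},\quad \eta=\frac1{4\ell},\quad \theta=\frac1{4\sqrt\kappa},\quad \gamma=\frac{\theta^2}{\eta},\quad s=\frac{\gamma}{4\rho},\quad \mathscr T=\sqrt\kappa\,\chi c,\quad r=\frac{\eta\,\epsilon}{\chi^{5}c^{8}},\quad \mathscr E=\sqrt{\frac{\epsilon^3}{\rho}}\;\chi^{-5}c^{-7}.$$ **Algorithm (PAGD).** Start at $x_0$ with $v_0=0$, and let $\xi_0,\xi_1,\dots$ be independent and uniformly distributed on the ball of radius $r$ around $0$. In iteration $t=0,1,2,\dots$: 1. If $\|\nabla f(x_t)\|\le\epsilon$ and no perturbation was added in the iterations $\tau\in[t-\mathscr T,t)$, add a perturbation: $\hat x_t=x_t+\xi_t$.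 Otherwise $\hat x_t=x_t$. 2. Let $y_t=\hat x_t+(1-\theta)v_t$. 3. If $y_t\ne \hat x_t$ and $f(\hat x_t)\le f(y_t)+\langle\nabla f(y_t),\hat x_t-y_t\rangle-\frac\gamma2\|\hat x_t-y_t\|^2$, perform negative curvature exploitation: set $v_{t+1}=0$, and let $x_{t+1}=\hat x_t$ if $\|v_t\|\ge s$, while if $\|v_t\|<s$ let $x_{t+1}$ be the one of the two points $\hat x_t\pm s\,v_t/\|v_t\|$ at which $f$ is smaller (the one with the plus sign in case of a tie). 4. Otherwise set $x_{t+1}=y_t-\eta\nabla f(y_t)$ and $v_{t+1}=x_{t+1}-\hat x_t$. The Hamiltonian is $E_t=f(x_t)+\frac1{2\eta}\|v_t\|^2$, where $x_t$ is the iterate before the perturbation of iteration $t$. **Lemma (Negative curvature).** There is an absolute constant $c_{\max}>0$ such that the following holds for all $d,f,\ell,\rho,\epsilon,\delta,\Delta_f,x_0$ as above, all $\chi\ge\max\{1,\log\frac{d\,\ell\,\Delta_f}{\epsilon^2\delta}\}$ and all $c\ge c_{\max}$. Run PAGD, and let $t\ge0$. Almost surely, if $\|\nabla f(x_t)\|\le\epsilon$,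 $\lambda_{\min}(\nabla^2f(x_t))<-\sqrt{\rho\epsilon}$, and no perturbation was added in the iterations $\tau\in[t-\mathscr T,t)$, then $$\mathbb P\bigl(E_{t+\lfloor\mathscr T\rfloor}-E_t\le-\mathscr E\;\big|\;\xi_0,\dots,\xi_{t-1}\bigr)\;\ge\;1-\frac{\delta\,\mathscr E}{2\Delta_f}.$$ -/

import Mathlib

open MeasureTheory ProbabilityTheory

/-- `ℝ^d` with its Euclidean norm. -/
abbrev Vec (d : ℕ) : Type := EuclideanSpace ℝ (Fin d)

/-- `f` is differentiable with `ℓ`-Lipschitz gradient. -/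
def IsSmoothWith {d : ℕ} (ℓ : ℝ) (f : Vec d → ℝ) : Prop :=
  Differentiable ℝ f ∧ ∀ x y : Vec d, ‖gradient f x - gradient f y‖ ≤ ℓ * ‖x - y‖

/-- The Hessian of `f` at `x`, as a linear operator on `ℝ^d` (its operator norm is the spectral
norm of the Hessian matrix). -/
noncomputable def hessian {d : ℕ} (f : Vec d → ℝ) (x : Vec d) : Vec d →L[ℝ] Vec d :=
  fderiv ℝ (gradient f) x

/-- `f` is twice differentiable with `ρ`-Lipschitz Hessian. -/
def IsHessianLipschitzWith {d : ℕ} (ρ : ℝ) (f : Vec d → ℝ) : Prop :=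
  Differentiable ℝ f ∧ Differentiable ℝ (gradient f) ∧
    ∀ x y : Vec d, ‖hessian f x - hessian f y‖ ≤ ρ * ‖x - y‖

/-- The minimum eigenvalue of an operator on `ℝ^d`. It is used for Hessians only; these are
symmetric, so that for `d ≥ 1` the set of eigenvalues is finite and non-empty. -/
noncomputable def minEigenvalue {d : ℕ} (A : Vec d →L[ℝ] Vec d) : ℝ :=
  sInf {μ : ℝ | Module.End.HasEigenvalue (A : Vec d →ₗ[ℝ] Vec d) μ}

/-- The hyperparameters of perturbed accelerated gradient descent (PAGD). The length `T` of the
waiting period between perturbations is a real number. -/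
structure PAGDParams where
  ε : ℝ
  η : ℝ
  θ : ℝ
  γ : ℝ
  s : ℝ
  r : ℝ
  T : ℝ

/-- What PAGD carries from one iteration to the next: the iterate `x`, the momentum `v`, and the
set of earlier iterations in which a perturbation was added. -/
structure PAGDState (d : ℕ) where
  x : Vec d
  v : Vec d
  perturbed : Finset ℕ

/-- No perturbation was added in the iterations `τ ∈ [t - T, t)`. -/
def NoRecentPerturbation {d : ℕ} (T : ℝ) (t : ℕ) (S : PAGDState d) : Prop :=
  ∀ τ ∈ S.perturbed, ¬ ((t : ℝ) - T ≤ (τ : ℝ) ∧ τ < t)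

/-- The precondition for adding a perturbation in iteration `t`. -/
def PerturbCondition {d : ℕ} (f : Vec d → ℝ) (p : PAGDParams) (t : ℕ) (S : PAGDState d) : Prop :=
  ‖gradient f S.x‖ ≤ p.ε ∧ NoRecentPerturbation p.T t S

/-- The certificate of negative curvature between `x` and `y`. For `x = y` the inequality is
trivially true and certifies nothing, so the two points are required to be distinct. -/
def NegCurvCertificate {d : ℕ} (f : Vec d → ℝ) (γ : ℝ) (x y : Vec d) : Prop :=
  x ≠ y ∧ f x ≤ f y + inner ℝ (gradient f y) (x - y) - γ / 2 * ‖x - y‖ ^ 2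

open Classical in
/-- Negative curvature exploitation: the next iterate (the new momentum is zero). -/
noncomputable def nceStep {d : ℕ} (f : Vec d → ℝ) (s : ℝ) (x v : Vec d) : Vec d :=
  if s ≤ ‖v‖ then x
  else if f (x + (s / ‖v‖) • v) ≤ f (x - (s / ‖v‖) • v) then x + (s / ‖v‖) • v
  else x - (s / ‖v‖) • v

/-- The momentum step of accelerated gradient descent, `y = x + (1 - θ) v`. -/
noncomputable def momentumPoint {d : ℕ} (θ : ℝ) (x v : Vec d) : Vec d := x + (1 - θ) • v

open Classical in
/-- The iterate of iteration `t` after the perturbation (if one is due) by the sample `ξ`. -/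
noncomputable def perturbedIterate {d : ℕ} (f : Vec d → ℝ) (p : PAGDParams) (t : ℕ) (ξ : Vec d)
    (S : PAGDState d) : Vec d :=
  if PerturbCondition f p t S then S.x + ξ else S.x

open Classical in
/-- The new pair of iterate and momentum, computed from the (possibly perturbed) iterate `x` and
the momentum `v`: an NCE step if the certificate holds, and otherwise a step of accelerated
gradient descent. -/
noncomputable def pagdMove {d : ℕ} (f : Vec d → ℝ) (p : PAGDParams) (x v : Vec d) :
    Vec d × Vec d :=
  if NegCurvCertificate f p.γ x (momentumPoint p.θ x v) then (nceStep f p.s x v, 0)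
  else
    let y := momentumPoint p.θ x v
    let x' := y - p.η • gradient f y
    (x', x' - x)

open Classical in
/-- Iteration `t` of PAGD; `ξ` is the sample that is used if a perturbation is due. -/
noncomputable def pagdStep {d : ℕ} (f : Vec d → ℝ) (p : PAGDParams) (t : ℕ) (ξ : Vec d)
    (S : PAGDState d) : PAGDState d where
  x := (pagdMove f p (perturbedIterate f p t ξ S) S.v).1
  v := (pagdMove f p (perturbedIterate f p t ξ S) S.v).2
  perturbed := if PerturbCondition f p t S then insert t S.perturbed else S.perturbed

/-- PAGD started at `x₀` with zero momentum and driven by the samples `ξ 0, ξ 1, …`: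
`pagd f p x₀ ξ t` is the state at the beginning of iteration `t`. -/
noncomputable def pagd {d : ℕ} (f : Vec d → ℝ) (p : PAGDParams) (x₀ : Vec d) (ξ : ℕ → Vec d) :
    ℕ → PAGDState d
  | 0 => ⟨x₀, 0, ∅⟩
  | t + 1 => pagdStep f p t (ξ t) (pagd f p x₀ ξ t)

/-- The Hamiltonian `E = f(x) + ‖v‖² / (2η)`. -/
noncomputable def hamiltonian {d : ℕ} (f : Vec d → ℝ) (η : ℝ) (S : PAGDState d) : ℝ :=
  f S.x + 1 / (2 * η) * ‖S.v‖ ^ 2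

/-- The condition number `κ = ℓ / √(ρε)`. -/
noncomputable def condNumber (ℓ ρ ε : ℝ) : ℝ := ℓ / √(ρ * ε)

/-- The choice of hyperparameters in the analysis of PAGD. -/
noncomputable def pagdParams (ℓ ρ ε χ c : ℝ) : PAGDParams :=
  let η := 1 / (4 * ℓ)
  let θ := 1 / (4 * √(condNumber ℓ ρ ε))
  let γ := θ ^ 2 / η
  { ε := ε
    η := η
    θ := θ
    γ := γ
    s := γ / (4 * ρ)
    r := η * ε / (χ ^ 5 * c ^ 8)
    T := √(condNumber ℓ ρ ε) * χ * c }

/-- The unit `𝓔 = √(ε³/ρ) · χ⁻⁵ c⁻⁷` of decrease of the Hamiltonian. -/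
noncomputable def energyUnit (ρ ε χ c : ℝ) : ℝ := √(ε ^ 3 / ρ) / (χ ^ 5 * c ^ 7)

/-! ### Taylor estimates from Lipschitz gradients and Hessians. -/

section Calculus

variable {d : ℕ} {f : Vec d → ℝ} {ℓ ρ : ℝ}

/-! After a perturbation at time t none follows for ⌊𝒯⌋ iterations, so the state at time t + ⌊𝒯⌋ is
a deterministic function of the state at t and of the single sample ξ_t, which is independent of the
past. It therefore suffices, for a fixed state, to show that the stuck samples, those from which the
Hamiltonian fails to drop by 𝓔, fill a small fraction of the ball.

The perturbation itself costs at most 𝓔 (`pairEnergy_perturbed_le`), so a stuck orbit loses less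
than 2𝓔 afterwards. One exploitation step would lose 2𝓔, and an accelerated step loses a multiple of
‖v‖². Hence a stuck orbit makes only accelerated steps and, by Cauchy–Schwarz, stays near its start
(`pagdOrbit_localized`). In that region the gradient is almost affine, with linear part the Hessian
at x_t. If two stuck samples differ by ζ e₀, with e₀ an eigenvector of most negative curvature, the
difference of their orbits solves a linear recurrence up to a small relative error and grows at
least like (1 + θ)^n (`IsGrowthPair.norm_ge`). Both orbits being localized, ζ is exponentially small
(`norm_sub_le_of_energy_gt`).

So the stuck region is thin in the direction e₀: many disjoint translates of it fit into a slightly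
larger ball, and its volume is small (`volume_le_of_line_diameter_lt`, `cond_volume_stuck_le`).
Fubini for the independent pair (past, ξ_t) turns this into the conditional bound
(`le_condProb_of_indepFun`). -/

theorem hasDerivAt_along_line (hf : Differentiable ℝ f) (y u : Vec d) (t : ℝ) :
    HasDerivAt (fun t : ℝ => f (y + t • u)) (inner ℝ (gradient f (y + t • u)) u) t := by
  have h1 : HasDerivAt (fun t : ℝ => y + t • u) u t := by
    simpa using ((hasDerivAt_id t).smul_const u).const_add y
  have h2 := (hf (y + t • u)).hasFDerivAt.comp_hasDerivAt t h1
  rw [inner_gradient_left]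
  exact h2

/-- Upper bound for the increment of `f` along a segment, from a bound for its derivative. -/
theorem sub_le_of_inner_gradient_le (hf : Differentiable ℝ f) (y u : Vec d) {q q' : ℝ → ℝ}
    (hq : ∀ t, HasDerivAt q (q' t) t)
    (h : ∀ t, 0 ≤ t → inner ℝ (gradient f (y + t • u)) u ≤ q' t) :
    f (y + u) - f y ≤ q 1 - q 0 := by
  have h1 : ∀ t, HasDerivAt (fun t : ℝ => f (y + t • u) - f y)
      (inner ℝ (gradient f (y + t • u)) u) t :=
    fun t => (hasDerivAt_along_line hf y u t).sub_const _
  have h2 : ∀ t, HasDerivAt (fun t : ℝ => q t - q 0) (q' t) t := fun t => (hq t).sub_const _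
  have := image_le_of_deriv_right_le_deriv_boundary (a := 0) (b := 1)
    (fun t _ => (h1 t).continuousAt.continuousWithinAt) (fun t _ => (h1 t).hasDerivWithinAt)
    (by simp) (fun t _ => (h2 t).continuousAt.continuousWithinAt)
    (fun t _ => (h2 t).hasDerivWithinAt) (fun t ht => h t ht.1)
    (Set.right_mem_Icc.2 zero_le_one)
  simpa using this

/-- Lower bound for the increment of `f` along a segment, from a bound for its derivative. -/
theorem le_sub_of_le_inner_gradient (hf : Differentiable ℝ f) (y u : Vec d) {q q' : ℝ → ℝ}
    (hq : ∀ t, HasDerivAt q (q' t) t)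
    (h : ∀ t, 0 ≤ t → q' t ≤ inner ℝ (gradient f (y + t • u)) u) :
    q 1 - q 0 ≤ f (y + u) - f y := by
  have h1 : ∀ t, HasDerivAt (fun t : ℝ => f (y + t • u) - f y)
      (inner ℝ (gradient f (y + t • u)) u) t :=
    fun t => (hasDerivAt_along_line hf y u t).sub_const _
  have h2 : ∀ t, HasDerivAt (fun t : ℝ => q t - q 0) (q' t) t := fun t => (hq t).sub_const _
  have := image_le_of_deriv_right_le_deriv_boundary (a := 0) (b := 1)
    (fun t _ => (h2 t).continuousAt.continuousWithinAt) (fun t _ => (h2 t).hasDerivWithinAt)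
    (by simp) (fun t _ => (h1 t).continuousAt.continuousWithinAt)
    (fun t _ => (h1 t).hasDerivWithinAt) (fun t ht => h t ht.1)
    (Set.right_mem_Icc.2 zero_le_one)
  simpa using this

theorem IsSmoothWith.le_quadratic (hf : IsSmoothWith ℓ f) (y u : Vec d) :
    f (y + u) ≤ f y + inner ℝ (gradient f y) u + ℓ / 2 * ‖u‖ ^ 2 := by
  have hq : ∀ t : ℝ, HasDerivAt
      (fun t : ℝ => t * inner ℝ (gradient f y) u + t ^ 2 * (ℓ / 2 * ‖u‖ ^ 2))
      (inner ℝ (gradient f y) u + ℓ * t * ‖u‖ ^ 2) t := by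
    intro t
    have h1 := (hasDerivAt_id t).mul_const (inner ℝ (gradient f y) u)
    have h2 := (hasDerivAt_pow 2 t).mul_const (ℓ / 2 * ‖u‖ ^ 2)
    refine (h1.add h2).congr_deriv ?_
    norm_num
    ring
  have := sub_le_of_inner_gradient_le hf.1 y u hq fun t ht => by
    have h3 : inner ℝ (gradient f (y + t • u) - gradient f y) u ≤ ℓ * ‖t • u‖ * ‖u‖ :=
      (real_inner_le_norm _ _).trans
        (mul_le_mul_of_nonneg_right (by simpa using hf.2 (y + t • u) y) (norm_nonneg _))
    rw [inner_sub_left, norm_smul, Real.norm_of_nonneg ht] at h3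
    nlinarith
  norm_num [-inner_gradient_left] at this
  linarith

/-- Mean value inequality on the ball of radius R around x, for the gradient minus its linearization
at x. This makes the difference of two localized orbits a linear recurrence with relative error. -/
theorem IsHessianLipschitzWith.norm_gradient_sub_le (hf : IsHessianLipschitzWith ρ f) (hρ : 0 ≤ ρ)
    {x a b : Vec d} {R : ℝ} (ha : ‖a - x‖ ≤ R) (hb : ‖b - x‖ ≤ R) :
    ‖gradient f a - gradient f b - hessian f x (a - b)‖ ≤ ρ * R * ‖a - b‖ := by
  refine (convex_closedBall x R).norm_image_sub_le_of_norm_fderiv_le' (𝕜 := ℝ)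
    (fun z _ => hf.2.1 z) (fun z hz => ?_) (by simpa [dist_eq_norm] using hb)
    (by simpa [dist_eq_norm] using ha)
  refine (hf.2.2 z x).trans (mul_le_mul_of_nonneg_left ?_ hρ)
  simpa [dist_eq_norm] using hz

/-- The sharp constant is ρ/2; the cruder ρ is enough, and is why the cubic Taylor remainders below
carry ρ/3 instead of ρ/6. -/
theorem IsHessianLipschitzWith.abs_inner_gradient_sub_le (hf : IsHessianLipschitzWith ρ f)
    (hρ : 0 ≤ ρ) (y u : Vec d) {t : ℝ} (ht : 0 ≤ t) :
    |inner ℝ (gradient f (y + t • u)) u - inner ℝ (gradient f y) u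
      - t * inner ℝ (hessian f y u) u| ≤ ρ * ‖u‖ ^ 3 * t ^ 2 := by
  have h := hf.norm_gradient_sub_le hρ (x := y) (a := y + t • u) (b := y) (R := ‖t • u‖)
    (by simp) (by simp)
  have h2 := (abs_real_inner_le_norm (gradient f (y + t • u) - gradient f y -
    hessian f y (y + t • u - y)) u).trans (mul_le_mul_of_nonneg_right h (norm_nonneg u))
  simp only [add_sub_cancel_left, inner_sub_left, map_smul, inner_smul_left, norm_smul,
    Real.norm_of_nonneg ht, conj_trivial] at h2
  refine h2.trans (le_of_eq ?_)
  ring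

theorem IsHessianLipschitzWith.taylor_le (hf : IsHessianLipschitzWith ρ f) (hρ : 0 ≤ ρ)
    (y u : Vec d) :
    f (y + u) ≤ f y + inner ℝ (gradient f y) u + inner ℝ (hessian f y u) u / 2
      + ρ / 3 * ‖u‖ ^ 3 := by
  have hq : ∀ t : ℝ, HasDerivAt
      (fun t : ℝ => t * inner ℝ (gradient f y) u + t ^ 2 * (inner ℝ (hessian f y u) u / 2)
        + t ^ 3 * (ρ / 3 * ‖u‖ ^ 3))
      (inner ℝ (gradient f y) u + t * inner ℝ (hessian f y u) u + ρ * ‖u‖ ^ 3 * t ^ 2) t := by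
    intro t
    have h1 := (hasDerivAt_id t).mul_const (inner ℝ (gradient f y) u)
    have h2 := (hasDerivAt_pow 2 t).mul_const (inner ℝ (hessian f y u) u / 2)
    have h3 := (hasDerivAt_pow 3 t).mul_const (ρ / 3 * ‖u‖ ^ 3)
    refine ((h1.add h2).add h3).congr_deriv ?_
    norm_num
    ring
  have := sub_le_of_inner_gradient_le hf.1 y u hq fun t ht => by
    have := (abs_le.1 (hf.abs_inner_gradient_sub_le hρ y u ht)).2
    linarith
  norm_num [-inner_gradient_left] at this
  linarith

theorem IsHessianLipschitzWith.le_taylor (hf : IsHessianLipschitzWith ρ f) (hρ : 0 ≤ ρ)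
    (y u : Vec d) :
    f y + inner ℝ (gradient f y) u + inner ℝ (hessian f y u) u / 2
      - ρ / 3 * ‖u‖ ^ 3 ≤ f (y + u) := by
  have hq : ∀ t : ℝ, HasDerivAt
      (fun t : ℝ => t * inner ℝ (gradient f y) u + t ^ 2 * (inner ℝ (hessian f y u) u / 2)
        - t ^ 3 * (ρ / 3 * ‖u‖ ^ 3))
      (inner ℝ (gradient f y) u + t * inner ℝ (hessian f y u) u - ρ * ‖u‖ ^ 3 * t ^ 2) t := by
    intro t
    have h1 := (hasDerivAt_id t).mul_const (inner ℝ (gradient f y) u)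
    have h2 := (hasDerivAt_pow 2 t).mul_const (inner ℝ (hessian f y u) u / 2)
    have h3 := (hasDerivAt_pow 3 t).mul_const (ρ / 3 * ‖u‖ ^ 3)
    refine ((h1.add h2).sub h3).congr_deriv ?_
    norm_num
    ring
  have := le_sub_of_le_inner_gradient hf.1 y u hq fun t ht => by
    have := (abs_le.1 (hf.abs_inner_gradient_sub_le hρ y u ht)).1
    linarith
  norm_num [-inner_gradient_left] at this
  linarith

theorem IsHessianLipschitzWith.hessian_symmetric (hf : IsHessianLipschitzWith ρ f) (x : Vec d) :
    (hessian f x : Vec d →ₗ[ℝ] Vec d).IsSymmetric := by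
  intro u v
  have h1 : ∀ y, HasFDerivAt f (innerSL ℝ (gradient f y)) y := fun y => by
    have h := (hf.1 y).hasFDerivAt
    rwa [show fderiv ℝ f y = innerSL ℝ (gradient f y) from
      ContinuousLinearMap.ext fun v => inner_gradient_left.symm] at h
  have h2 : HasFDerivAt (fun y => innerSL ℝ (gradient f y))
      ((innerSL ℝ).comp (hessian f x)) x :=
    (innerSL ℝ (E := Vec d)).hasFDerivAt.comp x (hf.2.1 x).hasFDerivAt
  have h3 := second_derivative_symmetric h1 h2 u v
  simp only [ContinuousLinearMap.comp_apply, innerSL_apply_apply] at h3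
  simp only [ContinuousLinearMap.coe_coe]
  rw [h3, real_inner_comm]

theorem IsSmoothWith.norm_hessian_le (hf : IsSmoothWith ℓ f) (hℓ : 0 ≤ ℓ) (x : Vec d) :
    ‖hessian f x‖ ≤ ℓ :=
  norm_fderiv_le_of_lip' ℝ hℓ (Filter.Eventually.of_forall fun y => hf.2 y x)

theorem IsSmoothWith.continuous_gradient (hf : IsSmoothWith ℓ f) (hℓ : 0 ≤ ℓ) :
    Continuous (gradient f) := by
  have : LipschitzWith ⟨ℓ, hℓ⟩ (gradient f) :=
    LipschitzWith.of_dist_le_mul fun x y => by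
      rw [dist_eq_norm, dist_eq_norm]; exact hf.2 x y
  exact this.continuous

end Calculus

/-! ### Second-order linear recurrences and exponential growth. -/

section Recurrence

/-- The impulse response of the recurrence `g (n + 2) = S * g (n + 1) - P * g n`. -/
def impulseResponse (S P : ℝ) : ℕ → ℝ
  | 0 => 0
  | 1 => 1
  | n + 2 => S * impulseResponse S P (n + 1) - P * impulseResponse S P n

/-- Duhamel's formula: by linearity, zero initial data leave only the superposed responses to the
forcing. -/
theorem impulseResponse_convolution (S P : ℝ) {D F : ℕ → ℝ} (h0 : D 0 = 0) (h1 : D 1 = 0)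
    (hD : ∀ n, D (n + 2) = S * D (n + 1) - P * D n + F n) (n : ℕ) :
    D (n + 1) = ∑ k ∈ Finset.range n, impulseResponse S P (n - k) * F k := by
  induction n using Nat.strong_induction_on with
  | _ n ih =>
    match n with
    | 0 => simpa using h1
    | 1 => simp [hD 0, h0, h1, impulseResponse]
    | n + 2 =>
      have e1 : ∑ k ∈ Finset.range n, impulseResponse S P (n - k) * F k =
          ∑ k ∈ Finset.range (n + 1), impulseResponse S P (n - k) * F k := by
        simp [Finset.sum_range_succ, impulseResponse]
      have e2 : ∀ k ∈ Finset.range (n + 1), impulseResponse S P (n + 2 - k) * F k =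
          S * (impulseResponse S P (n + 1 - k) * F k) - P * (impulseResponse S P (n - k) * F k) := by
        intro k hk
        obtain ⟨j, rfl⟩ : ∃ j, n = k + j := ⟨n - k, by grind⟩
        rw [show k + j + 2 - k = j + 2 by omega, show k + j + 1 - k = j + 1 by omega,
          show k + j - k = j by omega, impulseResponse]
        ring
      rw [hD (n + 1), ih (n + 1) (by omega), ih n (by omega), e1, Finset.sum_range_succ _ (n + 1),
        Finset.sum_congr rfl e2, Finset.sum_sub_distrib, Finset.mul_sum, Finset.mul_sum]
      simp [impulseResponse]

/-- Splitting off one factor leaves a first-order recurrence, whose solution sums n + 1 terms of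
size μ ^ n. No difference of roots is divided by, so nearly equal roots do no harm. -/
theorem abs_impulseResponse_le_of_factor {S P μ σ : ℝ} (hσ : |σ| ≤ μ)
    (h : ∀ n, |impulseResponse S P (n + 1) - σ * impulseResponse S P n| ≤ μ ^ n) (n : ℕ) :
    |impulseResponse S P (n + 1)| ≤ (n + 1) * μ ^ n := by
  induction n with
  | zero => simp [impulseResponse]
  | succ n ih =>
    have h1 := h (n + 1)
    have h2 : |σ * impulseResponse S P (n + 1)| ≤ μ * ((n + 1) * μ ^ n) := by
      rw [abs_mul]
      exact mul_le_mul hσ ih (abs_nonneg _) ((abs_nonneg _).trans hσ)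
    have h3 := abs_sub_abs_le_abs_sub (impulseResponse S P (n + 1 + 1))
      (σ * impulseResponse S P (n + 1))
    push_cast
    calc _ ≤ μ ^ (n + 1) + μ * ((n + 1) * μ ^ n) := by linarith
      _ = _ := by ring

theorem impulseResponse_sub_of_roots {S P z₁ z₂ : ℝ} (hS : z₁ + z₂ = S) (hP : z₁ * z₂ = P) (n : ℕ) :
    impulseResponse S P (n + 1) - z₂ * impulseResponse S P n = z₁ ^ n := by
  induction n with
  | zero => simp [impulseResponse]
  | succ n ih =>
    rw [impulseResponse, pow_succ, ← ih, ← hS, ← hP]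
    ring

/-- Each step multiplies this quadratic form by P. For complex roots it is positive definite, and
completing the square yields the factor estimate with σ = S / 2. -/
theorem impulseResponse_invariant (S P : ℝ) (n : ℕ) :
    impulseResponse S P (n + 1) ^ 2 - S * impulseResponse S P (n + 1) * impulseResponse S P n
      + P * impulseResponse S P n ^ 2 = P ^ n := by
  induction n with
  | zero => simp [impulseResponse]
  | succ n ih =>
    rw [pow_succ P, ← ih, impulseResponse]
    ring

/-- `μ` and `ν` are the roots of the characteristic polynomial of accelerated gradient descent in a
direction of curvature `-h/η`. -/
structure IsGrowthPair (θ h μ ν : ℝ) : Prop where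
  add_eq : μ + ν = (1 + h) * (2 - θ)
  mul_eq : μ * ν = (1 + h) * (1 - θ)
  one_add_le : 1 + θ ≤ μ
  le_two : μ ≤ 2
  nonneg : 0 ≤ ν
  le_one_sub : ν ≤ 1 - θ

/-- The roots are located by the sign of the characteristic polynomial: nonpositive at 1 + θ (this
uses h ≥ 2θ²) and at 1 - θ, nonnegative at 2 (this uses h ≤ 1/4). -/
theorem exists_isGrowthPair {θ h : ℝ} (hθ : 0 < θ) (hθ' : θ ≤ 1 / 4) (hh : 2 * θ ^ 2 ≤ h)
    (hh' : h ≤ 1 / 4) : ∃ μ ν, IsGrowthPair θ h μ ν := by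
  have hh0 : 0 < h := lt_of_lt_of_le (by positivity) hh
  set S := (1 + h) * (2 - θ) with hS
  set P := (1 + h) * (1 - θ) with hP
  have hD : 0 ≤ S ^ 2 - 4 * P := by
    have : S ^ 2 - 4 * P = (1 + h) * (θ ^ 2 + h * (2 - θ) ^ 2) := by rw [hS, hP]; ring
    rw [this]; positivity
  set R := √(S ^ 2 - 4 * P) with hR
  have hR0 : 0 ≤ R := Real.sqrt_nonneg _
  have hR2 : R ^ 2 = S ^ 2 - 4 * P := Real.sq_sqrt hD
  have hS0 : 0 ≤ S := mul_nonneg (by linarith) (by linarith)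
  have hP0 : 0 ≤ P := mul_nonneg (by linarith) (by linarith)
  have hRS : R ≤ S := by nlinarith
  have p1 : ((1 + θ) - (S + R) / 2) * ((1 + θ) - (S - R) / 2) ≤ 0 := by
    have : ((1 + θ) - (S + R) / 2) * ((1 + θ) - (S - R) / 2) =
      (1 + θ) ^ 2 - S * (1 + θ) + (S ^ 2 - R ^ 2) / 4 := by ring
    have h3 : (1 + θ) ^ 2 - S * (1 + θ) + (S ^ 2 - (S ^ 2 - 4 * P)) / 4 =
        2 * θ ^ 2 - h - h * θ * (2 - θ) := by rw [hS, hP]; ring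
    rw [this, hR2, h3]
    have := mul_nonneg (mul_nonneg hh0.le hθ.le) (by linarith : 0 ≤ 2 - θ)
    linarith
  have p2 : ((1 - θ) - (S + R) / 2) * ((1 - θ) - (S - R) / 2) ≤ 0 := by
    have : ((1 - θ) - (S + R) / 2) * ((1 - θ) - (S - R) / 2) =
      (1 - θ) ^ 2 - S * (1 - θ) + (S ^ 2 - R ^ 2) / 4 := by ring
    have h3 : (1 - θ) ^ 2 - S * (1 - θ) + (S ^ 2 - (S ^ 2 - 4 * P)) / 4 = - (h * (1 - θ) ^ 2) := by
      rw [hS, hP]; ring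
    rw [this, hR2, h3]
    have := mul_nonneg hh0.le (sq_nonneg (1 - θ))
    linarith
  have p3 : 0 ≤ (2 - (S + R) / 2) * (2 - (S - R) / 2) := by
    have : (2 - (S + R) / 2) * (2 - (S - R) / 2) = 4 - S * 2 + (S ^ 2 - R ^ 2) / 4 := by ring
    have h3 : 4 - S * 2 + (S ^ 2 - (S ^ 2 - 4 * P)) / 4 = 1 - 3 * h + θ * (1 + h) := by
      rw [hS, hP]; ring
    rw [this, hR2, h3]
    have := mul_nonneg hθ.le (by linarith : 0 ≤ 1 + h)
    linarith
  have q1 : 1 + θ ≤ (S + R) / 2 := by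
    by_contra! hc
    exact p1.not_gt (mul_pos (by linarith) (by linarith))
  have q2 : (S - R) / 2 ≤ 1 - θ := by
    by_contra! hc
    exact p2.not_gt (mul_pos_of_neg_of_neg (by linarith) (by linarith))
  refine ⟨(S + R) / 2, (S - R) / 2, by ring, ?_, q1, ?_, by linarith, q2⟩
  · rw [show (S + R) / 2 * ((S - R) / 2) = (S ^ 2 - R ^ 2) / 4 by ring, hR2]; ring
  · by_contra! hc
    exact p3.not_gt (mul_neg_of_neg_of_pos (by linarith) (by linarith))

namespace IsGrowthPair

variable {θ h μ ν : ℝ}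

/-- No curvature direction responds faster than the most negative one: complex roots have modulus √P
≤ μ, and the larger real root increases with b up to μ at b = 1 + h. -/
theorem abs_impulseResponse_le (H : IsGrowthPair θ h μ ν) (hθ : 0 < θ) {b : ℝ}
    (hb : 0 ≤ b) (hbh : b ≤ 1 + h) (n : ℕ) :
    |impulseResponse (b * (2 - θ)) (b * (1 - θ)) (n + 1)| ≤ (n + 1) * μ ^ n := by
  have hμ1 : 1 ≤ μ := by linarith [H.one_add_le]
  have hν1 : ν ≤ 1 := by linarith [H.le_one_sub]
  have hθ1 : 0 ≤ 1 - θ := by linarith [H.nonneg, H.le_one_sub]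
  set S := b * (2 - θ) with hS
  set P := b * (1 - θ) with hP
  have hS0 : 0 ≤ S := mul_nonneg hb (by linarith)
  have hP0 : 0 ≤ P := mul_nonneg hb hθ1
  have hPμ : P ≤ μ ^ 2 := by
    have : P ≤ μ * ν := by rw [H.mul_eq]; exact mul_le_mul_of_nonneg_right hbh hθ1
    nlinarith
  by_cases hD : S ^ 2 ≤ 4 * P
  · refine abs_impulseResponse_le_of_factor (σ := S / 2) ?_ (fun n => ?_) n
    · rw [abs_of_nonneg (by positivity)]
      nlinarith
    · refine abs_le_of_sq_le_sq ?_ (by positivity)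
      calc (impulseResponse S P (n + 1) - S / 2 * impulseResponse S P n) ^ 2
          = P ^ n - (P - S ^ 2 / 4) * impulseResponse S P n ^ 2 := by
            rw [← impulseResponse_invariant S P n]; ring
        _ ≤ P ^ n := by
            have := mul_nonneg (by linarith : 0 ≤ P - S ^ 2 / 4)
              (sq_nonneg (impulseResponse S P n))
            linarith
        _ ≤ (μ ^ 2) ^ n := pow_le_pow_left₀ hP0 hPμ n
        _ = (μ ^ n) ^ 2 := by ring
  · push Not at hD
    set R := √(S ^ 2 - 4 * P) with hR
    have hR0 : 0 ≤ R := Real.sqrt_nonneg _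
    have hR2 : R ^ 2 = S ^ 2 - 4 * P := Real.sq_sqrt (by linarith)
    have hRS : R ≤ S := by nlinarith
    -- At a root z > μ, raising b to 1 + h lowers the characteristic polynomial below its value 0,
    -- yet beyond its larger root μ it is positive.
    have hz : (S + R) / 2 ≤ μ := by
      by_contra! hc
      set z := (S + R) / 2 with hz
      have e1 : z ^ 2 - b * ((2 - θ) * z - (1 - θ)) = 0 := by
        have : z ^ 2 - S * z + P = 0 := by rw [hz]; nlinarith
        rw [hS, hP] at this
        linarith
      have e2 : 0 < (z - μ) * (z - ν) := mul_pos (by linarith) (by linarith)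
      have e3 : (z - μ) * (z - ν) = z ^ 2 - (1 + h) * ((2 - θ) * z - (1 - θ)) := by
        rw [show (z - μ) * (z - ν) = z ^ 2 - (μ + ν) * z + μ * ν by ring, H.add_eq, H.mul_eq]
        ring
      have e4 : 0 ≤ (2 - θ) * z - (1 - θ) := by nlinarith
      nlinarith [mul_le_mul_of_nonneg_right hbh e4]
    refine abs_impulseResponse_le_of_factor (σ := (S - R) / 2) ?_ (fun n => ?_) n
    · rw [abs_of_nonneg (by linarith)]
      linarith
    · rw [impulseResponse_sub_of_roots (z₁ := (S + R) / 2) (by ring) (by nlinarith),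
        abs_of_nonneg (by positivity)]
      exact pow_le_pow_left₀ (by positivity) hz n

/-- The solution of the homogeneous recurrence that starts at rest is comparable to `μ ^ n`. -/
theorem exists_homogeneous (H : IsGrowthPair θ h μ ν) (hθ : 0 < θ) :
    ∃ α : ℕ → ℝ, α 0 = 1 ∧ α 1 = 1 ∧
      (∀ n, α (n + 2) = (1 + h) * ((2 - θ) * α (n + 1) - (1 - θ) * α n)) ∧
      ∀ n, μ ^ n / 4 ≤ α n ∧ α n ≤ μ ^ n := by
  have h1 := H.one_add_le
  have h2 := H.le_one_sub
  have hμν : 0 < μ - ν := by linarith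
  -- The weight of μ ^ n in α. Since (μ - 1)(1 - ν) = h, one gets h ≤ 1 - ν and μ - ν = (μ + ν - 2)
  -- + 2(1 - ν) ≤ 2h + 2(1 - ν) ≤ 4(1 - ν).
  have hA : 1 / 4 ≤ (1 - ν) / (μ - ν) := by
    rw [le_div_iff₀ hμν]
    have e1 : (μ - 1) * (1 - ν) = h := by linarith [H.add_eq, H.mul_eq]
    have e2 : 0 ≤ h := by rw [← e1]; exact mul_nonneg (by linarith) (by linarith)
    have e3 : μ + ν - 2 ≤ 2 * ((μ - 1) * (1 - ν)) := by
      rw [e1, H.add_eq]; nlinarith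
    have e4 : (μ - 1) * (1 - ν) ≤ 1 * (1 - ν) :=
      mul_le_mul_of_nonneg_right (by linarith [H.le_two]) (by linarith)
    linarith
  have hB : 0 ≤ (μ - 1) / (μ - ν) := div_nonneg (by linarith) hμν.le
  have hAB : (1 - ν) / (μ - ν) + (μ - 1) / (μ - ν) = 1 := by
    field_simp; ring
  have eμ : μ ^ 2 = (1 + h) * ((2 - θ) * μ - (1 - θ)) := by
    linear_combination μ * H.add_eq - H.mul_eq
  have eν : ν ^ 2 = (1 + h) * ((2 - θ) * ν - (1 - θ)) := by
    linear_combination ν * H.add_eq - H.mul_eq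
  refine ⟨fun n => (1 - ν) / (μ - ν) * μ ^ n + (μ - 1) / (μ - ν) * ν ^ n, by simpa using hAB,
    ?_, fun n => ?_, fun n => ⟨?_, ?_⟩⟩
  · field_simp; ring
  · simp only [pow_add _ n 2, eμ, eν]
    ring
  · have := mul_le_mul_of_nonneg_right hA (pow_nonneg (by linarith : 0 ≤ μ) n)
    have := mul_nonneg hB (pow_nonneg H.nonneg n)
    dsimp only
    linarith
  · have := mul_le_mul_of_nonneg_left (pow_le_pow_left₀ H.nonneg (by linarith : ν ≤ μ) n) hB
    calc _ ≤ (1 - ν) / (μ - ν) * μ ^ n + (μ - 1) / (μ - ν) * μ ^ n := by linarith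
      _ = μ ^ n := by rw [← add_mul, hAB, one_mul]

end IsGrowthPair

theorem norm_sum_mul_inner_smul_le {ι E : Type*} [Fintype ι] [NormedAddCommGroup E]
    [InnerProductSpace ℝ E] (e : OrthonormalBasis ι ℝ E) {c : ι → ℝ} {C : ℝ} (hC : 0 ≤ C)
    (hc : ∀ i, |c i| ≤ C) (x : E) : ‖∑ i, (c i * inner ℝ (e i) x) • e i‖ ≤ C * ‖x‖ := by
  refine le_of_sq_le_sq ?_ (by positivity)
  rw [mul_pow, ← e.sum_sq_norm_inner_right, ← e.sum_sq_norm_inner_right x, Finset.mul_sum]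
  refine Finset.sum_le_sum fun i _ => ?_
  rw [e.orthonormal.inner_right_fintype, norm_mul, mul_pow]
  exact mul_le_mul_of_nonneg_right (by rw [Real.norm_eq_abs]; gcongr; exact hc i) (sq_nonneg _)

/-- Exponential growth, along an eigenvector of a symmetric operator with the largest eigenvalue
`1 + h`, of a perturbed accelerated iteration that starts at rest. -/
theorem IsGrowthPair.norm_ge {ι E : Type*} [Fintype ι] [NormedAddCommGroup E]
    [InnerProductSpace ℝ E] {θ h μ ν : ℝ} (H : IsGrowthPair θ h μ ν) (hθ : 0 < θ)
    (e : OrthonormalBasis ι ℝ E) (b : ι → ℝ) (hb : ∀ i, 0 ≤ b i) (hbh : ∀ i, b i ≤ 1 + h)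
    (B : E →ₗ[ℝ] E) (hB : ∀ i x, inner ℝ (e i) (B x) = b i * inner ℝ (e i) x)
    (i₀ : ι) (hi₀ : b i₀ = 1 + h) {φ ζ : ℝ} (hφ : 0 ≤ φ) (hζ : 0 ≤ ζ) {N : ℕ}
    (hN : 32 * φ * N ^ 2 ≤ 1) (U : ℕ → E) (hU0 : U 0 = ζ • e i₀) (hU1 : U 1 = ζ • e i₀)
    (hU : ∀ k < N, ‖U (k + 2) - B ((2 - θ) • U (k + 1) - (1 - θ) • U k)‖
      ≤ φ * ‖(2 - θ) • U (k + 1) - (1 - θ) • U k‖) :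
    μ ^ (N + 1) / 8 * ζ ≤ ‖U (N + 1)‖ := by
  have hμ1 : 1 ≤ μ := by linarith [H.one_add_le]
  have hθ1 : 0 ≤ 1 - θ := by linarith [H.nonneg, H.le_one_sub]
  obtain ⟨α, hα0, hα1, hα, hαμ⟩ := H.exists_homogeneous hθ
  set Y : ℕ → E := fun k => (2 - θ) • U (k + 1) - (1 - θ) • U k with hY
  set F : ℕ → E := fun k => U (k + 2) - B (Y k) with hF
  set D : ℕ → E := fun n => U n - (α n * ζ) • e i₀ with hD
  have hnα : ∀ n, ‖(α n * ζ) • e i₀‖ = α n * ζ := fun n => by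
    rw [norm_smul, e.norm_eq_one, mul_one, Real.norm_of_nonneg]
    exact mul_nonneg (le_trans (by positivity) (hαμ n).1) hζ
  have hconv : ∀ n, D (n + 1) = ∑ k ∈ Finset.range n, ∑ i,
      (impulseResponse (b i * (2 - θ)) (b i * (1 - θ)) (n - k) * inner ℝ (e i) (F k)) • e i := by
    intro n
    refine e.repr.injective (PiLp.ext fun i => ?_)
    rw [e.repr_apply_apply, e.repr_apply_apply, inner_sum]
    simp_rw [e.orthonormal.inner_right_fintype]
    refine impulseResponse_convolution _ _ (D := fun n => inner ℝ (e i) (D n))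
      (F := fun n => inner ℝ (e i) (F n)) ?_ ?_ (fun n => ?_) n
    · simp [hD, hU0, hα0]
    · simp [hD, hU1, hα1]
    · have hb' : b i * inner ℝ (e i) (e i₀) = (1 + h) * inner ℝ (e i) (e i₀) := by
        rcases eq_or_ne i i₀ with rfl | hne
        · rw [hi₀]
        · rw [e.orthonormal.2 hne]; simp
      simp only [hD, hF, hY, inner_sub_right, hB, inner_smul_right, hα]
      linear_combination ζ * ((2 - θ) * α (n + 1) - (1 - θ) * α n) * hb'
  -- Bootstrap: if the deviation D from the exact solution is below μ ^ k ζ / 8 so far, the forcing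
  -- at time k is O(φ μ ^ (k + 1) ζ), and Duhamel with responses at most N μ ^ j returns 4φN² μ ^ n
  -- ζ, with 4φN² ≤ 1/8. As α n ≥ μ ^ n / 4, the remaining eighth is the growth.
  have key : ∀ n ≤ N + 1, ‖D n‖ ≤ μ ^ n / 8 * ζ := by
    intro n
    induction n using Nat.strong_induction_on with
    | _ n ih =>
      intro hn
      have hUb : ∀ k < n, ‖U k‖ ≤ 9 / 8 * μ ^ k * ζ := by
        intro k hk
        have h1 := norm_add_le (D k) ((α k * ζ) • e i₀)
        rw [hnα] at h1
        simp only [hD, sub_add_cancel] at h1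
        have h2 := ih k hk (by omega)
        have h3 := mul_le_mul_of_nonneg_right (hαμ k).2 hζ
        simp only [hD] at h2
        linarith
      match n with
      | 0 => simp only [hD, hU0, hα0]; simp; positivity
      | n + 1 =>
        rw [hconv]
        have hterm : ∀ k ∈ Finset.range n, ‖∑ i, (impulseResponse (b i * (2 - θ)) (b i * (1 - θ))
            (n - k) * inner ℝ (e i) (F k)) • e i‖ ≤ N * (4 * φ * μ ^ n * ζ) := by
          intro k hk
          rw [Finset.mem_range] at hk
          obtain ⟨j, rfl⟩ : ∃ j, n = k + (j + 1) := ⟨n - k - 1, by omega⟩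
          rw [show k + (j + 1) - k = j + 1 by omega]
          have h1 := norm_sum_mul_inner_smul_le e (by positivity)
            (fun i => H.abs_impulseResponse_le hθ (hb i) (hbh i) j) (F k)
          have h2 : ‖Y k‖ ≤ 4 * μ ^ (k + 1) * ζ := by
            have h3 := norm_sub_le ((2 - θ) • U (k + 1)) ((1 - θ) • U k)
            rw [norm_smul, norm_smul, Real.norm_of_nonneg hθ1,
              Real.norm_of_nonneg (by linarith : 0 ≤ 2 - θ)] at h3
            have h4 := hUb (k + 1) (by omega)
            have h5 := hUb k (by omega)
            have h6 : 9 / 8 * μ ^ k * ζ ≤ 9 / 8 * μ ^ (k + 1) * ζ := by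
              exact mul_le_mul_of_nonneg_right (mul_le_mul_of_nonneg_left
                (pow_le_pow_right₀ hμ1 (Nat.le_succ k)) (by norm_num)) hζ
            have h7 : (2 - θ) * ‖U (k + 1)‖ ≤ 2 * ‖U (k + 1)‖ :=
              mul_le_mul_of_nonneg_right (by linarith) (norm_nonneg _)
            have h8 : (1 - θ) * ‖U k‖ ≤ 1 * ‖U k‖ :=
              mul_le_mul_of_nonneg_right (by linarith) (norm_nonneg _)
            have h9 : 0 ≤ μ ^ (k + 1) * ζ := by positivity
            simp only [hY]
            linarith
          have h3 : ‖F k‖ ≤ φ * (4 * μ ^ (k + 1) * ζ) :=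
            (hU k (by omega)).trans (mul_le_mul_of_nonneg_left h2 hφ)
          have h4 : ((j : ℝ) + 1) ≤ N := by exact_mod_cast (by omega : j + 1 ≤ N)
          calc _ ≤ (j + 1) * μ ^ j * ‖F k‖ := h1
            _ ≤ N * μ ^ j * (φ * (4 * μ ^ (k + 1) * ζ)) := by gcongr
            _ = N * (4 * φ * μ ^ (k + (j + 1)) * ζ) := by ring
        refine (norm_sum_le_of_le _ hterm).trans ?_
        rw [Finset.sum_const, Finset.card_range, nsmul_eq_mul]
        have hnN : (n : ℝ) ≤ N := by exact_mod_cast (by omega : n ≤ N)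
        calc (n : ℝ) * (N * (4 * φ * μ ^ n * ζ)) ≤ N * (N * (4 * φ * μ ^ n * ζ)) := by gcongr
          _ = 32 * φ * N ^ 2 * (μ ^ n / 8 * ζ) := by ring
          _ ≤ 1 * (μ ^ (n + 1) / 8 * ζ) := by
            refine mul_le_mul hN ?_ (by positivity) zero_le_one
            have := pow_le_pow_right₀ hμ1 (Nat.le_succ n)
            gcongr
          _ = _ := one_mul _
  have h1 := key (N + 1) le_rfl
  have h2 := norm_sub_norm_le ((α (N + 1) * ζ) • e i₀) (U (N + 1))
  rw [norm_sub_rev, hnα] at h2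
  have h3 := mul_le_mul_of_nonneg_right (hαμ (N + 1)).1 hζ
  simp only [hD] at h1
  linarith

end Recurrence

/-! ### Decrease of the Hamiltonian in each kind of step. -/

section Energy

variable {d : ℕ} {f : Vec d → ℝ} {ℓ ρ η θ γ s : ℝ} {x v : Vec d}

theorem le_of_not_negCurvCertificate {y : Vec d} (h : ¬ NegCurvCertificate f γ x y) :
    f y + inner ℝ (gradient f y) (x - y) - γ / 2 * ‖x - y‖ ^ 2 ≤ f x := by
  by_cases hxy : x = y
  · simp [hxy]
  · by_contra! hc
    exact h ⟨hxy, hc.le⟩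

/-- The Hamiltonian decreases in a step of accelerated gradient descent. -/
theorem IsSmoothWith.energy_agd_le (hf : IsSmoothWith ℓ f) (hℓ : 0 < ℓ) (hη : η = 1 / (4 * ℓ))
    (hθ : 0 < θ) (hθ' : θ ≤ 1) (hγ : γ * η = θ ^ 2)
    (hc : ¬ NegCurvCertificate f γ x (momentumPoint θ x v)) :
    f (momentumPoint θ x v - η • gradient f (momentumPoint θ x v))
      + 1 / (2 * η) * ‖momentumPoint θ x v - η • gradient f (momentumPoint θ x v) - x‖ ^ 2
      ≤ f x + 1 / (2 * η) * ‖v‖ ^ 2 - θ / (2 * η) * ‖v‖ ^ 2 := by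
  have hη0 : 0 < η := by rw [hη]; positivity
  have h1 := le_of_not_negCurvCertificate hc
  set y := momentumPoint θ x v with hy
  set g := gradient f y with hg
  have hxy : y - x = (1 - θ) • v := by simp [hy, momentumPoint]
  have h2 := hf.le_quadratic y (-(η • g))
  rw [← sub_eq_add_neg, norm_neg, norm_smul, inner_neg_right, inner_smul_right,
    real_inner_self_eq_norm_sq, Real.norm_of_nonneg hη0.le] at h2
  have h3 : ‖y - η • g - x‖ ^ 2 = (1 - θ) ^ 2 * ‖v‖ ^ 2 - 2 * η * inner ℝ g (y - x)
      + η ^ 2 * ‖g‖ ^ 2 := by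
    rw [show y - η • g - x = (y - x) - η • g by abel, norm_sub_sq_real, norm_smul,
      inner_smul_right, real_inner_comm, Real.norm_of_nonneg hη0.le, hxy, norm_smul, mul_pow,
      mul_pow, Real.norm_eq_abs, sq_abs]
    ring
  have h4 : ‖x - y‖ ^ 2 = (1 - θ) ^ 2 * ‖v‖ ^ 2 := by
    rw [norm_sub_rev, hxy, norm_smul, mul_pow, Real.norm_eq_abs, sq_abs]
  rw [h4, ← neg_sub y x, inner_neg_right] at h1
  rw [h3]
  have e1 : ℓ = 1 / (4 * η) := by rw [hη]; field_simp
  have e2 : γ = θ ^ 2 / η := by field_simp; linarith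
  -- The missing certificate costs the extra θ² (as γη = θ²), and friction still leaves the factor 1
  -- - θ. The gradient terms total -η‖g‖²(1 - 1/8 - 1/2) ≤ 0.
  have h5 : (1 - θ) ^ 2 * (1 + θ ^ 2) ≤ 1 - θ := by
    have : 0 ≤ (1 - θ) * (θ * ((1 - θ) * (1 - θ) + θ)) :=
      mul_nonneg (by linarith) (mul_nonneg hθ.le (by nlinarith))
    nlinarith
  have h6 : (1 - θ) ^ 2 * (1 + θ ^ 2) * (‖v‖ ^ 2 / (2 * η)) ≤ (1 - θ) * (‖v‖ ^ 2 / (2 * η)) :=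
    mul_le_mul_of_nonneg_right h5 (by positivity)
  have h7 : 0 ≤ η * ‖g‖ ^ 2 := by positivity
  rw [e1] at h2
  rw [e2] at h1
  have e3 : 1 / (4 * η) / 2 * (η * ‖g‖) ^ 2 = η * ‖g‖ ^ 2 / 8 := by field_simp; ring
  have e4 : 1 / (2 * η) * ((1 - θ) ^ 2 * ‖v‖ ^ 2 - 2 * η * inner ℝ g (y - x) + η ^ 2 * ‖g‖ ^ 2)
      = (1 - θ) ^ 2 * (‖v‖ ^ 2 / (2 * η)) - inner ℝ g (y - x) + η * ‖g‖ ^ 2 / 2 := by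
    field_simp
  have e5 : θ ^ 2 / η / 2 * ((1 - θ) ^ 2 * ‖v‖ ^ 2) =
      (1 - θ) ^ 2 * θ ^ 2 * (‖v‖ ^ 2 / (2 * η)) := by field_simp
  have e6 : 1 / (2 * η) * ‖v‖ ^ 2 = ‖v‖ ^ 2 / (2 * η) := by ring
  have e7 : θ / (2 * η) * ‖v‖ ^ 2 = θ * (‖v‖ ^ 2 / (2 * η)) := by ring
  rw [e4, e6, e7]
  rw [e3] at h2
  rw [e5] at h1
  linarith

/-- The Hamiltonian decreases in a step of negative curvature exploitation. -/
theorem IsHessianLipschitzWith.energy_nce_le (hf : IsHessianLipschitzWith ρ f) (hρ : 0 < ρ)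
    (hη : 0 < η) (hθ : 0 < θ) (hθ' : θ < 1) (hγ : 0 < γ) (hs : s = γ / (4 * ρ))
    (hc : NegCurvCertificate f γ x (momentumPoint θ x v)) :
    f (nceStep f s x v) ≤ f x + 1 / (2 * η) * ‖v‖ ^ 2
      - min (s ^ 2 / (2 * η)) (γ * s ^ 2 / 8) := by
  have hs0 : 0 < s := by rw [hs]; positivity
  by_cases hv : s ≤ ‖v‖
  · rw [nceStep, if_pos hv]
    have h1 : s ^ 2 / (2 * η) ≤ 1 / (2 * η) * ‖v‖ ^ 2 := by
      rw [one_div_mul_eq_div]; gcongr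
    linarith [min_le_left (s ^ 2 / (2 * η)) (γ * s ^ 2 / 8)]
  · have hmin : f (nceStep f s x v) ≤
        (f (x + (s / ‖v‖) • v) + f (x - (s / ‖v‖) • v)) / 2 := by
      rw [nceStep, if_neg hv]
      split_ifs <;> linarith
    push Not at hv
    obtain ⟨hne, hcert⟩ := hc
    set y := momentumPoint θ x v with hy
    set u := x - y with hu
    have hu0 : 0 < ‖u‖ := norm_pos_iff.2 (sub_ne_zero.2 hne)
    have huv : u = (-(1 - θ)) • v := by
      simp only [hu, hy, momentumPoint]; module
    have hnu : ‖u‖ = (1 - θ) * ‖v‖ := by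
      rw [huv, norm_smul, norm_neg, Real.norm_of_nonneg (by linarith)]
    have hv0 : 0 < ‖v‖ := by
      by_contra! h0
      have : ‖v‖ = 0 := le_antisymm h0 (norm_nonneg _)
      rw [this, mul_zero] at hnu
      exact hu0.ne' hnu
    have hus : ‖u‖ ≤ s := by nlinarith
    have h1 := hf.le_taylor hρ.le y u
    rw [show y + u = x by simp [hu]] at h1
    have h2 : inner ℝ (hessian f x u) u ≤ inner ℝ (hessian f y u) u + ρ * ‖u‖ ^ 3 := by
      have h3 := (real_inner_le_norm ((hessian f x - hessian f y) u) u).trans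
        (mul_le_mul_of_nonneg_right (((hessian f x - hessian f y).le_opNorm u).trans
          (mul_le_mul_of_nonneg_right (hf.2.2 x y) (norm_nonneg _))) (norm_nonneg _))
      rw [sub_apply, inner_sub_left] at h3
      have : ρ * ‖x - y‖ * ‖u‖ * ‖u‖ = ρ * ‖u‖ ^ 3 := by rw [← hu]; ring
      linarith
    -- The certificate and Taylor at y give curvature at most -γ + (2/3)ρ‖u‖ there; moving the
    -- Hessian from y to x costs another ρ‖u‖.
    have h3 : inner ℝ (hessian f x u) u ≤ (-γ + 5 / 3 * (ρ * s)) * ‖u‖ ^ 2 := by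
      have h4 : ρ * ‖u‖ ^ 3 ≤ ρ * s * ‖u‖ ^ 2 := by
        rw [pow_succ', ← mul_assoc]; gcongr
      linarith
    set w := (s / ‖v‖) • v with hw
    have hwn : ‖w‖ = s := by
      rw [hw, norm_smul, Real.norm_of_nonneg (by positivity)]; field_simp
    have hwu : w = (-(s / ((1 - θ) * ‖v‖))) • u := by
      rw [huv, hw, smul_smul]
      congr 1
      have : 1 - θ ≠ 0 := by linarith
      field_simp
    have h4 : inner ℝ (hessian f x w) w ≤ (-γ + 5 / 3 * (ρ * s)) * s ^ 2 := by
      have e1 : s ^ 2 = (s / ((1 - θ) * ‖v‖)) ^ 2 * ‖u‖ ^ 2 := by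
        rw [hnu]
        have : 1 - θ ≠ 0 := by linarith
        field_simp
      rw [e1, hwu, map_smul, inner_smul_left, inner_smul_right]
      simp only [conj_trivial]
      have := mul_le_mul_of_nonneg_left h3 (sq_nonneg (s / ((1 - θ) * ‖v‖)))
      linarith
    have h5 := hf.taylor_le hρ.le x w
    have h6 := hf.taylor_le hρ.le x (-w)
    rw [← sub_eq_add_neg] at h6
    simp only [inner_neg_right, map_neg, inner_neg_left, neg_neg, norm_neg, hwn] at h5 h6
    have e2 : ρ * s = γ / 4 := by rw [hs]; field_simp
    have e3 : ρ / 3 * s ^ 3 = γ / 12 * s ^ 2 := by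
      rw [show ρ / 3 * s ^ 3 = (ρ * s) * s ^ 2 / 3 by ring, e2]; ring
    rw [e2] at h4
    rw [e3] at h5 h6
    have h7 : 0 ≤ 1 / (2 * η) * ‖v‖ ^ 2 := by positivity
    have h8 : 0 ≤ γ * s ^ 2 := by positivity
    have h9 := min_le_right (s ^ 2 / (2 * η)) (γ * s ^ 2 / 8)
    linarith

end Energy

/-! ### Unperturbed orbits and their localization. -/

section Orbit

/-- The hyperparameters of PAGD in terms of `σ = √(ρε)` and `k = √κ`. -/
noncomputable def normalizedParams (σ k ρ χ c : ℝ) : PAGDParams :=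
  { ε := σ ^ 2 / ρ
    η := 1 / (4 * (σ * k ^ 2))
    θ := 1 / (4 * k)
    γ := σ / 4
    s := σ / (16 * ρ)
    r := σ / (4 * ρ * k ^ 2 * (χ ^ 5 * c ^ 8))
    T := k * χ * c }

/-- The unit of decrease of the Hamiltonian in terms of `σ = √(ρε)`. -/
noncomputable def normalizedEnergyUnit (σ ρ χ c : ℝ) : ℝ := σ ^ 3 / ρ ^ 2 / (χ ^ 5 * c ^ 7)

/-- In σ and k all square roots disappear, so later parameter comparisons are between monomials; ε ≤
ℓ²/ρ becomes k ≥ 1. -/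
theorem exists_pagdParams_eq_normalizedParams {ℓ ρ ε : ℝ} (hℓ : 0 < ℓ) (hρ : 0 < ρ) (hε : 0 < ε)
    (hεℓ : ε ≤ ℓ ^ 2 / ρ) (χ c : ℝ) :
    ∃ σ k : ℝ, 0 < σ ∧ 1 ≤ k ∧ ℓ = σ * k ^ 2 ∧ √(ρ * ε) = σ ∧ ε = σ ^ 2 / ρ ∧
      energyUnit ρ ε χ c = normalizedEnergyUnit σ ρ χ c ∧
      pagdParams ℓ ρ ε χ c = normalizedParams σ k ρ χ c := by
  have hσ : 0 < √(ρ * ε) := Real.sqrt_pos.2 (by positivity)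
  have hσ2 : √(ρ * ε) ^ 2 = ρ * ε := Real.sq_sqrt (by positivity)
  have hκ : 1 ≤ condNumber ℓ ρ ε := by
    rw [condNumber, one_le_div hσ]
    refine Real.sqrt_le_iff.2 ⟨hℓ.le, ?_⟩
    rw [le_div_iff₀ hρ] at hεℓ
    linarith
  have hk2 : √(condNumber ℓ ρ ε) ^ 2 = condNumber ℓ ρ ε := Real.sq_sqrt (by linarith)
  have hk : 1 ≤ √(condNumber ℓ ρ ε) := Real.one_le_sqrt.2 hκ
  have hℓσ : ℓ = √(ρ * ε) * √(condNumber ℓ ρ ε) ^ 2 := by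
    rw [hk2, condNumber]; field_simp
  have hεσ : ε = √(ρ * ε) ^ 2 / ρ := by rw [hσ2]; field_simp
  refine ⟨√(ρ * ε), √(condNumber ℓ ρ ε), hσ, hk, hℓσ, rfl, hεσ, ?_, ?_⟩
  · rw [energyUnit, normalizedEnergyUnit]
    congr 1
    rw [Real.sqrt_eq_iff_mul_self_eq (by positivity) (by positivity)]
    have : √(ρ * ε) ^ 3 / ρ ^ 2 * (√(ρ * ε) ^ 3 / ρ ^ 2) = (√(ρ * ε) ^ 2) ^ 3 / ρ ^ 4 := by
      field_simp
    rw [this, hσ2]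
    field_simp
  · set k := √(condNumber ℓ ρ ε) with hk_def
    set σ := √(ρ * ε) with hσ_def
    have hk0 : 0 < k := by linarith
    simp only [pagdParams, normalizedParams, ← hk_def, PAGDParams.mk.injEq]
    refine ⟨hεσ, by rw [hℓσ], trivial, ?_, ?_, ?_, trivial⟩
    · rw [hℓσ]; field_simp
    · rw [hℓσ]; field_simp; norm_num
    · rw [hℓσ, hεσ]; field_simp

variable {d : ℕ}

/-- The iterates of PAGD without perturbations, started at the pair `z` of iterate and momentum. -/
noncomputable def pagdOrbit (f : Vec d → ℝ) (p : PAGDParams) (z : Vec d × Vec d) (n : ℕ) :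
    Vec d × Vec d :=
  (fun z => pagdMove f p z.1 z.2)^[n] z

/-- The Hamiltonian of a pair of iterate and momentum. -/
noncomputable def pairEnergy (f : Vec d → ℝ) (η : ℝ) (z : Vec d × Vec d) : ℝ :=
  f z.1 + 1 / (2 * η) * ‖z.2‖ ^ 2

theorem pagdOrbit_zero (f : Vec d → ℝ) (p : PAGDParams) (z : Vec d × Vec d) :
    pagdOrbit f p z 0 = z := rfl

theorem pagdOrbit_succ (f : Vec d → ℝ) (p : PAGDParams) (z : Vec d × Vec d) (n : ℕ) :
    pagdOrbit f p z (n + 1) =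
      pagdMove f p (pagdOrbit f p z n).1 (pagdOrbit f p z n).2 :=
  Function.iterate_succ_apply' _ _ _

variable {f : Vec d → ℝ} {σ k ρ χ c : ℝ}

theorem pairEnergy_pagdMove_le_of_not_cert (hf : IsSmoothWith (σ * k ^ 2) f) (hσ : 0 < σ)
    (hk : 1 ≤ k) (z : Vec d × Vec d)
    (hz : ¬ NegCurvCertificate f (normalizedParams σ k ρ χ c).γ z.1
      (momentumPoint (normalizedParams σ k ρ χ c).θ z.1 z.2)) :
    pairEnergy f (normalizedParams σ k ρ χ c).η
        (pagdMove f (normalizedParams σ k ρ χ c) z.1 z.2) ≤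
      pairEnergy f (normalizedParams σ k ρ χ c).η z - σ * k / 2 * ‖z.2‖ ^ 2 := by
  have hk0 : 0 < k := by linarith
  have := hf.energy_agd_le (by positivity) (η := (normalizedParams σ k ρ χ c).η) rfl
    (θ := (normalizedParams σ k ρ χ c).θ) (by simp only [normalizedParams]; positivity)
    (by simp only [normalizedParams]; rw [div_le_one (by positivity)]; linarith)
    (by simp only [normalizedParams]; field_simp) hz
  rw [pagdMove, if_neg hz]
  refine this.trans (le_of_eq ?_)
  rw [pairEnergy]
  congr 2
  simp only [normalizedParams]
  field_simp

/-- The factor 2 leaves one unit to pay for the perturbation and one for the claimed decrease. -/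
theorem pairEnergy_pagdMove_le_of_cert (hf : IsHessianLipschitzWith ρ f) (hρ : 0 < ρ) (hσ : 0 < σ)
    (hk : 1 ≤ k) (hχ : 1 ≤ χ) (hc : 4 ≤ c) (z : Vec d × Vec d)
    (hz : NegCurvCertificate f (normalizedParams σ k ρ χ c).γ z.1
      (momentumPoint (normalizedParams σ k ρ χ c).θ z.1 z.2)) :
    pairEnergy f (normalizedParams σ k ρ χ c).η
        (pagdMove f (normalizedParams σ k ρ χ c) z.1 z.2) ≤
      pairEnergy f (normalizedParams σ k ρ χ c).η z - 2 * normalizedEnergyUnit σ ρ χ c := by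
  have hk0 : 0 < k := by linarith
  have := hf.energy_nce_le hρ (η := (normalizedParams σ k ρ χ c).η)
    (s := (normalizedParams σ k ρ χ c).s) (by simp only [normalizedParams]; positivity)
    (θ := (normalizedParams σ k ρ χ c).θ) (by simp only [normalizedParams]; positivity)
    (by simp only [normalizedParams]; rw [div_lt_one (by positivity)]; linarith)
    (by simp only [normalizedParams]; positivity)
    (by simp only [normalizedParams]; field_simp; norm_num) hz
  rw [pagdMove, if_pos hz]
  -- Here γs²/8 is exactly σ³/(8192ρ²), and c ≥ 4 makes 2𝓔 at most that.
  have hX : 16384 ≤ χ ^ 5 * c ^ 7 := by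
    calc (16384 : ℝ) = 1 ^ 5 * 4 ^ 7 := by norm_num
      _ ≤ χ ^ 5 * c ^ 7 := by gcongr
  have hmin : 2 * normalizedEnergyUnit σ ρ χ c ≤ min
      ((normalizedParams σ k ρ χ c).s ^ 2 / (2 * (normalizedParams σ k ρ χ c).η))
      ((normalizedParams σ k ρ χ c).γ * (normalizedParams σ k ρ χ c).s ^ 2 / 8) := by
    have e0 : 2 * normalizedEnergyUnit σ ρ χ c ≤ σ ^ 3 / ρ ^ 2 / 8192 := by
      rw [normalizedEnergyUnit, ← mul_div_assoc, div_le_div_iff₀ (by positivity) (by norm_num)]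
      nlinarith [show 0 < σ ^ 3 / ρ ^ 2 by positivity]
    have hk2 : 1 ≤ k ^ 2 := one_le_pow₀ hk
    refine e0.trans (le_min ?_ (le_of_eq ?_)) <;> simp only [normalizedParams]
    · have : (σ / (16 * ρ)) ^ 2 / (2 * (1 / (4 * (σ * k ^ 2)))) =
          σ ^ 3 / ρ ^ 2 / 128 * k ^ 2 := by field_simp; norm_num
      rw [this]
      nlinarith [show 0 < σ ^ 3 / ρ ^ 2 by positivity]
    · field_simp; norm_num
  simp only [pairEnergy, norm_zero]
  linarith

theorem normalizedEnergyUnit_nonneg (hσ : 0 < σ) (hχ : 1 ≤ χ) (hc : 4 ≤ c) :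
    0 ≤ normalizedEnergyUnit σ ρ χ c := by
  rw [normalizedEnergyUnit]
  positivity

/-- An orbit along which the Hamiltonian decreases by little contains no negative curvature
exploitation, and stays near its starting point. -/
theorem pagdOrbit_localized (hf : IsSmoothWith (σ * k ^ 2) f) (hf' : IsHessianLipschitzWith ρ f)
    (hρ : 0 < ρ) (hσ : 0 < σ) (hk : 1 ≤ k) (hχ : 1 ≤ χ) (hc : 4 ≤ c) {n : ℕ}
    (hn : n ≤ (normalizedParams σ k ρ χ c).T) {z : Vec d × Vec d}
    (hz : pairEnergy f (normalizedParams σ k ρ χ c).η z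
        - 2 * normalizedEnergyUnit σ ρ χ c
      < pairEnergy f (normalizedParams σ k ρ χ c).η
        (pagdOrbit f (normalizedParams σ k ρ χ c) z n)) :
    ∀ j < n, ¬ NegCurvCertificate f (normalizedParams σ k ρ χ c).γ
        (pagdOrbit f (normalizedParams σ k ρ χ c) z j).1
        (momentumPoint (normalizedParams σ k ρ χ c).θ
          (pagdOrbit f (normalizedParams σ k ρ χ c) z j).1
          (pagdOrbit f (normalizedParams σ k ρ χ c) z j).2) ∧
      ‖(pagdOrbit f (normalizedParams σ k ρ χ c) z j).1 - z.1‖ ≤ 2 * σ / (ρ * χ ^ 2 * c ^ 3) ∧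
      ‖(pagdOrbit f (normalizedParams σ k ρ χ c) z j).2‖ ≤ 2 * σ / (ρ * χ ^ 2 * c ^ 3) := by
  have hk0 : 0 < k := by linarith
  set p := normalizedParams σ k ρ χ c with hp
  set Z := pagdOrbit f p z with hZ
  have hmono : Antitone fun j => pairEnergy f p.η (Z j) := by
    refine antitone_nat_of_succ_le fun j => ?_
    rw [hZ, pagdOrbit_succ, ← hZ]
    by_cases hcert : NegCurvCertificate f p.γ (Z j).1 (momentumPoint p.θ (Z j).1 (Z j).2)
    · have := pairEnergy_pagdMove_le_of_cert hf' hρ hσ hk hχ hc (Z j) hcert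
      have := normalizedEnergyUnit_nonneg (ρ := ρ) hσ hχ hc
      linarith
    · have := pairEnergy_pagdMove_le_of_not_cert hf hσ hk (Z j) hcert
      have : 0 ≤ σ * k / 2 * ‖(Z j).2‖ ^ 2 := by positivity
      linarith
  have hnc : ∀ j < n, ¬ NegCurvCertificate f p.γ (Z j).1
      (momentumPoint p.θ (Z j).1 (Z j).2) := by
    intro j hj hcert
    have h1 := pairEnergy_pagdMove_le_of_cert hf' hρ hσ hk hχ hc (Z j) hcert
    rw [hZ, ← pagdOrbit_succ] at h1
    have h2 := hmono (Nat.zero_le j)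
    have h3 := hmono (Nat.succ_le_of_lt hj)
    simp only [hZ, pagdOrbit_zero] at h2 h3
    simp only [Nat.succ_eq_add_one] at h3
    linarith
  have hsum : ∀ m ≤ n, σ * k / 2 * ∑ j ∈ Finset.range m, ‖(Z j).2‖ ^ 2 ≤
      pairEnergy f p.η z - pairEnergy f p.η (Z m) := by
    intro m
    induction m with
    | zero => simp [hZ, pagdOrbit_zero]
    | succ m ih =>
      intro hm
      have h1 := pairEnergy_pagdMove_le_of_not_cert hf hσ hk (Z m) (hnc m hm)
      rw [hZ, ← pagdOrbit_succ, ← hZ] at h1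
      rw [Finset.sum_range_succ, mul_add]
      linarith [ih (by omega)]
  -- Cauchy–Schwarz over n ≤ T steps: the square of the path length is at most T · 4𝓔/(σk), which is
  -- the square of the right-hand side.
  have hS : ∑ j ∈ Finset.range n, ‖(Z j).2‖ ≤ 2 * σ / (ρ * χ ^ 2 * c ^ 3) := by
    refine le_of_sq_le_sq ?_ (by positivity)
    have h1 := sq_sum_le_card_mul_sum_sq (s := Finset.range n) (f := fun j => ‖(Z j).2‖)
    rw [Finset.card_range] at h1
    have h2 : ∑ j ∈ Finset.range n, ‖(Z j).2‖ ^ 2 ≤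
        4 * normalizedEnergyUnit σ ρ χ c / (σ * k) := by
      rw [le_div_iff₀ (by positivity)]
      linarith [hsum n le_rfl]
    refine h1.trans ((mul_le_mul hn h2 (by positivity) ?_).trans (le_of_eq ?_))
    · simp only [hp, normalizedParams]; positivity
    · simp only [hp, normalizedParams, normalizedEnergyUnit]
      field_simp
      norm_num
  have hstep : ∀ j < n, (Z (j + 1)).1 = (Z j).1 + (Z (j + 1)).2 := by
    intro j hj
    have : Z (j + 1) = pagdMove f p (Z j).1 (Z j).2 := by rw [hZ, pagdOrbit_succ]
    rw [this, pagdMove, if_neg (hnc j hj)]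
    simp
  have hdist : ∀ j < n, ‖(Z j).1 - z.1‖ ≤ ∑ i ∈ Finset.range (j + 1), ‖(Z i).2‖ := by
    intro j
    induction j with
    | zero => intro _; simp [hZ, pagdOrbit_zero]
    | succ j ih =>
      intro hj
      rw [Finset.sum_range_succ, hstep j (by omega), add_sub_right_comm]
      exact (norm_add_le _ _).trans (by linarith [ih (by omega)])
  refine fun j hj => ⟨hnc j hj, (hdist j hj).trans (le_trans ?_ hS), le_trans ?_ hS⟩
  · exact Finset.sum_le_sum_of_subset_of_nonneg (Finset.range_subset_range.2 hj)
      fun _ _ _ => norm_nonneg _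
  · exact Finset.single_le_sum (f := fun j => ‖(Z j).2‖) (fun _ _ => norm_nonneg _)
      (Finset.mem_range.2 hj)

end Orbit

/-! ### Two stuck orbits cannot start far apart along the escape direction. -/

section Coupling

variable {d : ℕ} {f : Vec d → ℝ} {σ k ρ χ c : ℝ}

theorem exists_minimal_eigenbasis {A : Vec d →L[ℝ] Vec d}
    (hA : (A : Vec d →ₗ[ℝ] Vec d).IsSymmetric) {m : ℝ} (hm : m ≤ 0) (h : minEigenvalue A < m) :
    ∃ (e : OrthonormalBasis (Fin d) ℝ (Vec d)) (eig : Fin d → ℝ) (i₀ : Fin d),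
      (∀ i, A (e i) = eig i • e i) ∧ (∀ i, eig i₀ ≤ eig i) ∧ eig i₀ < m := by
  have hd : Module.finrank ℝ (Vec d) = d := by simp
  -- For d = 0 the spectrum is empty and `sInf ∅ = 0`, which m ≤ 0 rules out.
  have hne : {μ : ℝ | Module.End.HasEigenvalue (A : Vec d →ₗ[ℝ] Vec d) μ}.Nonempty := by
    by_contra hc
    rw [Set.not_nonempty_iff_eq_empty] at hc
    rw [minEigenvalue, hc, Real.sInf_empty] at h
    linarith
  obtain ⟨l, hl, hlm⟩ := exists_lt_of_csInf_lt hne h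
  have happ : ∀ i, A (hA.eigenvectorBasis hd i) = hA.eigenvalues hd i • hA.eigenvectorBasis hd i :=
    hA.apply_eigenvectorBasis hd
  obtain ⟨j, hj⟩ := hA.exists_eigenvalues_eq hd hl
  have hjl : hA.eigenvalues hd j = l := hj
  obtain ⟨i₀, -, hi₀⟩ := Finset.exists_min_image Finset.univ (hA.eigenvalues hd) ⟨j, by simp⟩
  exact ⟨hA.eigenvectorBasis hd, hA.eigenvalues hd, i₀, happ, fun i => hi₀ i (by simp),
    by linarith [hi₀ j (by simp)]⟩

/-- Of two orbits that start from perturbations which differ along the direction of most negative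
curvature, the Hamiltonian of one decreases, unless the difference is tiny. -/
theorem norm_sub_le_of_energy_gt (hf : IsSmoothWith (σ * k ^ 2) f)
    (hf' : IsHessianLipschitzWith ρ f) (hρ : 0 < ρ) (hσ : 0 < σ) (hk : 1 ≤ k) (hχ : 1 ≤ χ)
    (hc : 48 ≤ c) {N : ℕ} (hN : (N + 1 : ℕ) ≤ (normalizedParams σ k ρ χ c).T) {x v u u' : Vec d}
    (hu : ‖u‖ ≤ (normalizedParams σ k ρ χ c).r) (hu' : ‖u'‖ ≤ (normalizedParams σ k ρ χ c).r)
    (e : OrthonormalBasis (Fin d) ℝ (Vec d)) (eig : Fin d → ℝ) (i₀ : Fin d)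
    (he : ∀ i, hessian f x (e i) = eig i • e i) (hmin : ∀ i, eig i₀ ≤ eig i) (hi₀ : eig i₀ ≤ -σ)
    {ζ : ℝ} (hζ : 0 ≤ ζ) (huζ : u - u' = ζ • e i₀)
    (hz : pairEnergy f (normalizedParams σ k ρ χ c).η (x + u, v)
        - 2 * normalizedEnergyUnit σ ρ χ c
      < pairEnergy f (normalizedParams σ k ρ χ c).η
        (pagdOrbit f (normalizedParams σ k ρ χ c) (x + u, v) (N + 1)))
    (hz' : pairEnergy f (normalizedParams σ k ρ χ c).η (x + u', v)
        - 2 * normalizedEnergyUnit σ ρ χ c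
      < pairEnergy f (normalizedParams σ k ρ χ c).η
        (pagdOrbit f (normalizedParams σ k ρ χ c) (x + u', v) (N + 1))) :
    (1 + 1 / (4 * k)) ^ (N + 1) / 8 * ζ ≤ 8 * σ / (ρ * χ ^ 2 * c ^ 3) := by
  have hk0 : 0 < k := by linarith
  have hχ0 : 0 < χ := by linarith
  have hc0 : 0 < c := by linarith
  have L := pagdOrbit_localized hf hf' hρ hσ hk hχ (by linarith) hN hz
  have L' := pagdOrbit_localized hf hf' hρ hσ hk hχ (by linarith) hN hz'
  have hrS : (normalizedParams σ k ρ χ c).r ≤ 2 * σ / (ρ * χ ^ 2 * c ^ 3) := by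
    simp only [normalizedParams]
    rw [div_le_div_iff₀ (by positivity) (by positivity)]
    have h1 : 1 ≤ k ^ 2 * χ ^ 3 * c ^ 5 :=
      one_le_mul_of_one_le_of_one_le (one_le_mul_of_one_le_of_one_le (one_le_pow₀ hk)
        (one_le_pow₀ hχ)) (one_le_pow₀ (by linarith))
    have h2 : 0 < σ * (ρ * χ ^ 2 * c ^ 3) := by positivity
    have h3 := mul_le_mul_of_nonneg_left h1 h2.le
    linarith
  have hθ : (normalizedParams σ k ρ χ c).θ = 1 / (4 * k) := rfl
  have hη : (normalizedParams σ k ρ χ c).η = 1 / (4 * (σ * k ^ 2)) := rfl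
  have hT : (normalizedParams σ k ρ χ c).T = k * χ * c := rfl
  set p := normalizedParams σ k ρ χ c with hp
  set R := 2 * σ / (ρ * χ ^ 2 * c ^ 3) with hR
  set Z := pagdOrbit f p (x + u, v) with hZ
  set Z' := pagdOrbit f p (x + u', v) with hZ'
  have hη0 : 0 < p.η := by rw [hη]; positivity
  have hθ0 : 0 < p.θ := by rw [hθ]; positivity
  have hθ4 : p.θ ≤ 1 / 4 := by
    rw [hθ]; exact one_div_le_one_div_of_le (by norm_num) (by linarith)
  have hR0 : 0 < R := by positivity
  -- the growth rate
  have heig : ∀ i, |eig i| ≤ σ * k ^ 2 := by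
    intro i
    have h1 := (hessian f x).le_of_opNorm_le (hf.norm_hessian_le (by positivity) x) (e i)
    rwa [he, norm_smul, e.norm_eq_one, mul_one, mul_one] at h1
  have hηeig : ∀ i, |p.η * eig i| ≤ 1 / 4 := by
    intro i
    rw [abs_mul, abs_of_pos hη0]
    calc p.η * |eig i| ≤ p.η * (σ * k ^ 2) := mul_le_mul_of_nonneg_left (heig i) hη0.le
      _ = 1 / 4 := by rw [hη]; field_simp
  -- Curvature below -σ gives h ≥ ησ = 4θ², twice what the growth pair needs.
  have hh : 2 * p.θ ^ 2 ≤ -(p.η * eig i₀) := by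
    have h1 : p.η * σ ≤ -(p.η * eig i₀) := by nlinarith
    refine le_trans ?_ h1
    have h2 : p.η * σ = 4 * p.θ ^ 2 := by rw [hη, hθ]; field_simp
    rw [h2]
    nlinarith [sq_nonneg p.θ]
  obtain ⟨μ, ν, H⟩ := exists_isGrowthPair hθ0 hθ4 hh (by linarith [neg_abs_le (p.η * eig i₀), hηeig i₀])
  -- the difference of the two orbits
  have hstep : ∀ j < N + 1, (Z (j + 1)).1 = momentumPoint p.θ (Z j).1 (Z j).2
        - p.η • gradient f (momentumPoint p.θ (Z j).1 (Z j).2) ∧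
      (Z (j + 1)).2 = (Z (j + 1)).1 - (Z j).1 := by
    intro j hj
    have : Z (j + 1) = pagdMove f p (Z j).1 (Z j).2 := by rw [hZ, pagdOrbit_succ]
    rw [this, pagdMove, if_neg (L j hj).1]
    exact ⟨rfl, rfl⟩
  have hstep' : ∀ j < N + 1, (Z' (j + 1)).1 = momentumPoint p.θ (Z' j).1 (Z' j).2
        - p.η • gradient f (momentumPoint p.θ (Z' j).1 (Z' j).2) ∧
      (Z' (j + 1)).2 = (Z' (j + 1)).1 - (Z' j).1 := by
    intro j hj
    have : Z' (j + 1) = pagdMove f p (Z' j).1 (Z' j).2 := by rw [hZ', pagdOrbit_succ]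
    rw [this, pagdMove, if_neg (L' j hj).1]
    exact ⟨rfl, rfl⟩
  -- Truncated subtraction repeats the initial difference, U 0 = U 1, which encodes the equal
  -- initial momenta. Thus U (N + 1) is the difference at time N, the last time at which
  -- localization is known.
  set U : ℕ → Vec d := fun j => (Z (j - 1)).1 - (Z' (j - 1)).1 with hU
  have hU0 : (Z 0).1 - (Z' 0).1 = ζ • e i₀ := by
    simp [hZ, hZ', pagdOrbit_zero, huζ]
  have hmom : ∀ j < N + 1, (2 - p.θ) • U (j + 1) - (1 - p.θ) • U j =
      momentumPoint p.θ (Z j).1 (Z j).2 - momentumPoint p.θ (Z' j).1 (Z' j).2 := by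
    intro j hj
    match j with
    | 0 =>
      change (2 - p.θ) • ((x + u) - (x + u')) - (1 - p.θ) • ((x + u) - (x + u')) =
        (x + u + (1 - p.θ) • v) - (x + u' + (1 - p.θ) • v)
      module
    | j + 1 =>
      simp only [hU, momentumPoint, (hstep j (by omega)).2, (hstep' j (by omega)).2]
      simp only [Nat.add_sub_cancel]
      module
  have hyx : ∀ j < N + 1, ‖momentumPoint p.θ (Z j).1 (Z j).2 - x‖ ≤ 3 * R := by
    intro j hj
    have h1 : momentumPoint p.θ (Z j).1 (Z j).2 - x =
        ((Z j).1 - (x + u)) + u + (1 - p.θ) • (Z j).2 := by simp only [momentumPoint]; abel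
    have h2 : ‖(1 - p.θ) • (Z j).2‖ ≤ 1 * ‖(Z j).2‖ := by
      rw [norm_smul, Real.norm_of_nonneg (by linarith)]
      exact mul_le_mul_of_nonneg_right (by linarith) (norm_nonneg _)
    rw [h1]
    refine (norm_add₃_le).trans ?_
    linarith [(L j hj).2.1, (L j hj).2.2]
  have hyx' : ∀ j < N + 1, ‖momentumPoint p.θ (Z' j).1 (Z' j).2 - x‖ ≤ 3 * R := by
    intro j hj
    have h1 : momentumPoint p.θ (Z' j).1 (Z' j).2 - x =
        ((Z' j).1 - (x + u')) + u' + (1 - p.θ) • (Z' j).2 := by simp only [momentumPoint]; abel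
    have h2 : ‖(1 - p.θ) • (Z' j).2‖ ≤ 1 * ‖(Z' j).2‖ := by
      rw [norm_smul, Real.norm_of_nonneg (by linarith)]
      exact mul_le_mul_of_nonneg_right (by linarith) (norm_nonneg _)
    rw [h1]
    refine (norm_add₃_le).trans ?_
    linarith [(L' j hj).2.1, (L' j hj).2.2]
  set B : Vec d →ₗ[ℝ] Vec d := LinearMap.id - p.η • (hessian f x : Vec d →ₗ[ℝ] Vec d) with hB
  have hBe : ∀ i w, inner ℝ (e i) (B w) = (1 - p.η * eig i) * inner ℝ (e i) w := by
    intro i w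
    have h1 := hf'.hessian_symmetric x (e i) w
    simp only [ContinuousLinearMap.coe_coe, he, inner_smul_left, conj_trivial] at h1
    simp only [hB, LinearMap.sub_apply, LinearMap.id_apply, LinearMap.smul_apply,
      ContinuousLinearMap.coe_coe, inner_sub_right, inner_smul_right, ← h1]
    ring
  -- The total relative error is at most 48 / c; this is the source of the threshold c ≥ 48.
  have hφN : 32 * (p.η * (ρ * (3 * R))) * (N : ℝ) ^ 2 ≤ 1 := by
    have h1 : (N : ℝ) ≤ k * χ * c := by
      rw [← hT]; refine le_trans ?_ hN; push_cast; linarith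
    have h2 : (N : ℝ) ^ 2 ≤ (k * χ * c) ^ 2 := pow_le_pow_left₀ (Nat.cast_nonneg N) h1 2
    calc 32 * (p.η * (ρ * (3 * R))) * (N : ℝ) ^ 2
        ≤ 32 * (p.η * (ρ * (3 * R))) * (k * χ * c) ^ 2 := by gcongr
      _ = 48 / c := by rw [hη, hR]; field_simp; norm_num
      _ ≤ 1 := (div_le_one hc0).2 hc
  have hgrow := H.norm_ge hθ0 e (fun i => 1 - p.η * eig i)
    (fun i => by linarith [le_abs_self (p.η * eig i), hηeig i])
    (fun i => by nlinarith [hmin i]) B hBe i₀ (by ring)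
    (φ := p.η * (ρ * (3 * R))) (by positivity) hζ hφN U (by simpa [hU] using hU0)
    (by simpa [hU] using hU0) (fun j hj => by
      rw [hmom j (by omega)]
      have h1 := hf'.norm_gradient_sub_le hρ.le (hyx j (by omega)) (hyx' j (by omega))
      have h2 : U (j + 2) = (Z (j + 1)).1 - (Z' (j + 1)).1 := rfl
      rw [h2, (hstep j (by omega)).1, (hstep' j (by omega)).1]
      generalize momentumPoint p.θ (Z j).1 (Z j).2 = y at *
      generalize momentumPoint p.θ (Z' j).1 (Z' j).2 = y' at *
      have h3 : y - p.η • gradient f y - (y' - p.η • gradient f y') - B (y - y') =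
          -(p.η • (gradient f y - gradient f y' - hessian f x (y - y'))) := by
        simp only [hB, LinearMap.sub_apply, LinearMap.id_apply, LinearMap.smul_apply,
          ContinuousLinearMap.coe_coe]
        module
      rw [h3, norm_neg, norm_smul, Real.norm_of_nonneg hη0.le, mul_assoc]
      exact mul_le_mul_of_nonneg_left h1 hη0.le)
  have hUN : ‖U (N + 1)‖ ≤ 4 * R := by
    have h1 : U (N + 1) = ((Z N).1 - (x + u)) - ((Z' N).1 - (x + u')) + u - u' := by
      simp only [hU, Nat.add_sub_cancel]; abel
    rw [h1]
    have h2 := norm_sub_le ((Z N).1 - (x + u) - ((Z' N).1 - (x + u')) + u) u'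
    have h3 := norm_add_le ((Z N).1 - (x + u) - ((Z' N).1 - (x + u'))) u
    have h4 := norm_sub_le ((Z N).1 - (x + u)) ((Z' N).1 - (x + u'))
    linarith [(L N (by omega)).2.1, (L' N (by omega)).2.1]
  have hpow : (1 + 1 / (4 * k)) ^ (N + 1) ≤ μ ^ (N + 1) :=
    pow_le_pow_left₀ (by positivity) (by rw [← hθ]; exact H.one_add_le) _
  calc (1 + 1 / (4 * k)) ^ (N + 1) / 8 * ζ ≤ μ ^ (N + 1) / 8 * ζ := by gcongr
    _ ≤ 4 * R := hgrow.trans hUN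
    _ = 8 * σ / (ρ * χ ^ 2 * c ^ 3) := by rw [hR]; ring

end Coupling

/-! ### Measurability, dependence on the past, and the run after a perturbation. -/

section Measurability

variable {d : ℕ} {f : Vec d → ℝ} {p : PAGDParams}

theorem measurable_pagdMove (hf : Continuous f) (hg : Continuous (gradient f)) :
    Measurable fun z : Vec d × Vec d => pagdMove f p z.1 z.2 := by
  have hm : Continuous fun z : Vec d × Vec d => momentumPoint p.θ z.1 z.2 := by
    unfold momentumPoint; fun_prop
  have hgm : Continuous fun z : Vec d × Vec d => gradient f (momentumPoint p.θ z.1 z.2) :=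
    hg.comp hm
  have hfm : Continuous fun z : Vec d × Vec d => f (momentumPoint p.θ z.1 z.2) := hf.comp hm
  have hf1 : Continuous fun z : Vec d × Vec d => f z.1 := hf.comp continuous_fst
  have hcert : MeasurableSet {z : Vec d × Vec d |
      NegCurvCertificate f p.γ z.1 (momentumPoint p.θ z.1 z.2)} := by
    refine MeasurableSet.inter ?_ ?_
    · exact (measurableSet_eq_fun measurable_fst hm.measurable).compl
    · exact (isClosed_le hf1 (by fun_prop)).measurableSet
  have hw : Measurable fun z : Vec d × Vec d => (p.s / ‖z.2‖) • z.2 := by fun_prop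
  have hnce : Measurable fun z : Vec d × Vec d => nceStep f p.s z.1 z.2 := by
    refine Measurable.ite (measurableSet_le measurable_const measurable_snd.norm) measurable_fst
      (Measurable.ite (measurableSet_le ?_ ?_) ?_ ?_)
    · exact hf.measurable.comp (measurable_fst.add hw)
    · exact hf.measurable.comp (measurable_fst.sub hw)
    · exact measurable_fst.add hw
    · exact measurable_fst.sub hw
  refine Measurable.ite hcert (hnce.prodMk measurable_const) (Continuous.measurable ?_)
  fun_prop

theorem measurable_pagdOrbit (hf : Continuous f) (hg : Continuous (gradient f)) (n : ℕ) :
    Measurable fun z : Vec d × Vec d => pagdOrbit f p z n :=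
  (measurable_pagdMove hf hg).iterate n

theorem measurable_pairEnergy (hf : Continuous f) (η : ℝ) : Measurable (pairEnergy f η) := by
  unfold pairEnergy
  have : Continuous fun z : Vec d × Vec d => f z.1 := hf.comp continuous_fst
  fun_prop

theorem measurableSet_perturbCondition {α : Type*} [MeasurableSpace α]
    (hg : Continuous (gradient f)) (t : ℕ) {S : α → PAGDState d} (hx : Measurable fun a => (S a).x)
    (hp : Measurable[_, ⊤] fun a => (S a).perturbed) :
    MeasurableSet {a | PerturbCondition f p t (S a)} := by
  refine MeasurableSet.inter ?_ ?_
  · exact measurableSet_le (hg.measurable.comp hx).norm measurable_const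
  · exact hp (t := {F | ∀ τ ∈ F, ¬ ((t : ℝ) - p.T ≤ (τ : ℝ) ∧ τ < t)}) trivial

theorem measurable_pagd (hf : Continuous f) (hg : Continuous (gradient f)) (x₀ : Vec d) (t : ℕ) :
    (Measurable fun ξ : ℕ → Vec d => (pagd f p x₀ ξ t).x) ∧
    (Measurable fun ξ : ℕ → Vec d => (pagd f p x₀ ξ t).v) ∧
    Measurable[_, ⊤] fun ξ : ℕ → Vec d => (pagd f p x₀ ξ t).perturbed := by
  induction t with
  | zero => exact ⟨measurable_const, measurable_const, measurable_const⟩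
  | succ t ih =>
    obtain ⟨hx, hv, hp⟩ := ih
    have hC := measurableSet_perturbCondition (p := p) hg t hx hp
    have hxp : Measurable fun ξ : ℕ → Vec d =>
        perturbedIterate f p t (ξ t) (pagd f p x₀ ξ t) :=
      Measurable.ite hC (hx.add (measurable_pi_apply t)) hx
    have hmove := (measurable_pagdMove (p := p) hf hg).comp (hxp.prodMk hv)
    refine ⟨measurable_fst.comp hmove, measurable_snd.comp hmove, ?_⟩
    let _ : MeasurableSpace (Finset ℕ) := ⊤
    exact Measurable.ite hC ((measurable_from_top (f := insert t)).comp hp) hp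

theorem pagd_congr (x₀ : Vec d) {ξ ξ' : ℕ → Vec d} {t : ℕ} (h : ∀ τ < t, ξ τ = ξ' τ) :
    pagd f p x₀ ξ t = pagd f p x₀ ξ' t := by
  induction t with
  | zero => rfl
  | succ t ih => rw [pagd, pagd, ih fun τ hτ => h τ (by omega), h t (by omega)]

/-- After a perturbation, PAGD runs without perturbations for `⌊T⌋` iterations. -/
theorem pagd_add_eq_pagdOrbit (x₀ : Vec d) (ξ : ℕ → Vec d) {t : ℕ}
    (h : PerturbCondition f p t (pagd f p x₀ ξ t)) {n : ℕ} (hn : (n + 1 : ℕ) ≤ p.T) :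
    ((pagd f p x₀ ξ (t + (n + 1))).x, (pagd f p x₀ ξ (t + (n + 1))).v) =
        pagdOrbit f p ((pagd f p x₀ ξ t).x + ξ t, (pagd f p x₀ ξ t).v) (n + 1) ∧
      t ∈ (pagd f p x₀ ξ (t + (n + 1))).perturbed := by
  induction n with
  | zero =>
    rw [pagdOrbit_succ, pagdOrbit_zero]
    simp [pagd, pagdStep, perturbedIterate, h]
  | succ n ih =>
    have hn' : ((n + 1 : ℕ) : ℝ) ≤ p.T := le_trans (by exact_mod_cast Nat.le_succ _) hn
    obtain ⟨h1, h2⟩ := ih hn'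
    -- The perturbation at t is still inside the waiting window, because n + 1 ≤ T.
    have h3 : ¬ PerturbCondition f p (t + (n + 1)) (pagd f p x₀ ξ (t + (n + 1))) := by
      intro hc
      refine hc.2 t h2 ⟨?_, by omega⟩
      push_cast at hn' ⊢
      linarith
    rw [pagdOrbit_succ, ← h1, ← add_assoc t (n + 1) 1, pagd]
    generalize pagd f p x₀ ξ (t + (n + 1)) = S at *
    simp [pagdStep, perturbedIterate, h3, h2]

end Measurability

/-! ### Volume of sets that are thin in one direction. -/

section Volume

/-- The K + 1 translates of X by multiples of r/(dK) along w are disjoint and lie in the ball of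
radius (1 + 1/d) r, whose volume exceeds that of the r-ball by a factor at most e < 3. -/
theorem volume_le_of_line_diameter_lt {d : ℕ} (hd : 0 < d) {X : Set (Vec d)}
    (hX : MeasurableSet X) {r : ℝ} (hr : 0 < r) (hXr : X ⊆ Metric.closedBall 0 r) {w : Vec d}
    (hw : ‖w‖ = 1) {K : ℕ} (hK : 0 < K)
    (hline : ∀ u ∈ X, ∀ u' ∈ X, ∀ ζ : ℝ, 0 ≤ ζ → u - u' = ζ • w → ζ < r / (d * K)) :
    (K + 1) * volume X ≤ 3 * volume (Metric.closedBall (0 : Vec d) r) := by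
  have hd' : (0 : ℝ) < d := by exact_mod_cast hd
  have hK' : (0 : ℝ) < K := by exact_mod_cast hK
  set r₀ := r / (d * K) with hr₀
  have hr₀0 : 0 < r₀ := by positivity
  set Y : ℕ → Set (Vec d) := fun k => (fun y => y - ((k : ℝ) * r₀) • w) ⁻¹' X with hY
  have hYX : ∀ k, volume (Y k) = volume X := fun k => by
    simp only [hY, sub_eq_add_neg]
    exact measure_preimage_add_right _ _ _
  have hdisj : ∀ j k, j < k → Disjoint (Y j) (Y k) := by
    intro j k hjk
    rw [Set.disjoint_left]
    intro y hj hk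
    have h1 := hline _ hj _ hk (((k : ℝ) - j) * r₀) (by
      have : (j : ℝ) ≤ k := by exact_mod_cast hjk.le
      exact mul_nonneg (by linarith) hr₀0.le) (by module)
    have h2 : (j : ℝ) + 1 ≤ k := by exact_mod_cast hjk
    nlinarith
  have hsub : (⋃ k ∈ Finset.range (K + 1), Y k) ⊆ Metric.closedBall 0 ((1 + 1 / d) * r) := by
    intro y hy
    simp only [Set.mem_iUnion, Finset.mem_range] at hy
    obtain ⟨k, hk, hyk⟩ := hy
    have h1 := hXr hyk
    rw [mem_closedBall_zero_iff] at h1 ⊢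
    have h2 := norm_add_le (y - ((k : ℝ) * r₀) • w) (((k : ℝ) * r₀) • w)
    rw [sub_add_cancel, norm_smul, hw, mul_one, Real.norm_of_nonneg (by positivity)] at h2
    have h3 : (k : ℝ) * r₀ ≤ K * r₀ := by
      have : (k : ℝ) ≤ K := by exact_mod_cast Nat.lt_succ_iff.1 hk
      gcongr
    have h4 : K * r₀ = 1 / d * r := by rw [hr₀]; field_simp
    linarith
  have h1 : volume (⋃ k ∈ Finset.range (K + 1), Y k) = (K + 1) * volume X := by
    rw [measure_biUnion_finset]
    · simp [hYX]
    · intro j _ k _ hjk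
      rcases lt_or_gt_of_ne hjk with h | h
      exacts [hdisj j k h, (hdisj k j h).symm]
    · exact fun k _ => hX.preimage (measurable_id.sub_const _)
  rw [← h1]
  refine (measure_mono hsub).trans ?_
  rw [Measure.addHaar_closedBall_mul _ _ (by positivity) hr.le]
  gcongr
  rw [← ENNReal.ofReal_ofNat 3]
  refine ENNReal.ofReal_le_ofReal ?_
  rw [finrank_euclideanSpace_fin]
  have h2 : (1 + 1 / (d : ℝ)) ^ d ≤ Real.exp 1 := by
    calc (1 + 1 / (d : ℝ)) ^ d ≤ Real.exp (1 / d) ^ d := by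
          gcongr
          linarith [Real.add_one_le_exp (1 / (d : ℝ))]
      _ = Real.exp 1 := by rw [← Real.exp_nat_mul]; field_simp
  linarith [Real.exp_one_lt_d9]

end Volume

/-! ### Exponential growth against polynomial factors. -/

section Numerics

/-- The exponent χc/16 is split in half: one half absorbs exp χ, since c ≥ 32, the other the
polynomial, bounded by a multiple of (χc)^12. -/
theorem exists_exp_dominates : ∃ C : ℝ, 48 ≤ C ∧ ∀ c, C ≤ c → ∀ χ, 1 ≤ χ →
    2048 * χ ^ 8 * c ^ 12 * Real.exp χ < Real.exp (χ * c / 16) := by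
  have h := (Real.tendsto_exp_div_pow_atTop 12).eventually_gt_atTop (2048 * 32 ^ 12)
  obtain ⟨Y, hY⟩ := Filter.eventually_atTop.1 h
  refine ⟨max 48 (32 * Y), le_max_left _ _, fun c hc χ hχ => ?_⟩
  have hc48 : 48 ≤ c := (le_max_left _ _).trans hc
  have hcY : 32 * Y ≤ c := (le_max_right _ _).trans hc
  have hχc : c ≤ χ * c := le_mul_of_one_le_left (by linarith) hχ
  have h1 := hY (χ * c / 32) (by linarith)
  rw [lt_div_iff₀ (by positivity)] at h1
  have h2 : Real.exp χ ≤ Real.exp (χ * c / 32) := Real.exp_le_exp.2 (by nlinarith)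
  have h3 : 2048 * χ ^ 8 * c ^ 12 ≤ 2048 * 32 ^ 12 * (χ * c / 32) ^ 12 := by
    have : χ ^ 8 ≤ χ ^ 12 := pow_le_pow_right₀ hχ (by norm_num)
    calc 2048 * χ ^ 8 * c ^ 12 ≤ 2048 * χ ^ 12 * c ^ 12 := by gcongr
      _ = _ := by ring
  calc 2048 * χ ^ 8 * c ^ 12 * Real.exp χ
      ≤ 2048 * 32 ^ 12 * (χ * c / 32) ^ 12 * Real.exp (χ * c / 32) := by gcongr
    _ < Real.exp (χ * c / 32) * Real.exp (χ * c / 32) := by gcongr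
    _ = Real.exp (χ * c / 16) := by rw [← Real.exp_add]; ring_nf

/-- With T = kχc, θT = χc/4. One factor 2 is lost in 1 + θ ≥ exp (θ/2), another in ⌊T⌋ ≥ T/2. -/
theorem exp_le_one_add_pow_floor {k χ c : ℝ} (hk : 1 ≤ k) (hχ : 1 ≤ χ) (hc : 48 ≤ c) :
    Real.exp (χ * c / 16) ≤ (1 + 1 / (4 * k)) ^ ⌊k * χ * c⌋₊ := by
  have hk0 : 0 < k := by linarith
  have hT : 48 ≤ k * χ * c := by
    calc (48 : ℝ) = 1 * 1 * 48 := by norm_num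
      _ ≤ k * χ * c := by gcongr
  set θ := 1 / (4 * k) with hθ
  have hθ0 : 0 < θ := by positivity
  have hθ1 : θ ≤ 1 := by rw [hθ, div_le_one (by positivity)]; linarith
  have h1 : Real.exp (θ / 2) ≤ 1 + θ := by
    have h2 := Real.add_one_le_exp (-(θ / 2))
    have h3 : Real.exp (θ / 2) * Real.exp (-(θ / 2)) = 1 := by rw [← Real.exp_add]; simp
    have h4 := Real.exp_pos (θ / 2)
    have h5 : Real.exp (θ / 2) * (1 - θ / 2) ≤ 1 := by
      rw [← h3]; gcongr; linarith
    have h6 : 1 ≤ (1 + θ) * (1 - θ / 2) := by nlinarith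
    exact le_of_mul_le_mul_right (h5.trans h6) (by linarith)
  calc Real.exp (χ * c / 16) ≤ Real.exp (⌊k * χ * c⌋₊ * (θ / 2)) := by
        refine Real.exp_le_exp.2 ?_
        have h2 := (Nat.lt_floor_add_one (k * χ * c)).le
        have h3 : χ * c / 16 = (k * χ * c / 2) * (θ / 2) := by rw [hθ]; field_simp; norm_num
        rw [h3]
        gcongr
        linarith
    _ = Real.exp (θ / 2) ^ ⌊k * χ * c⌋₊ := Real.exp_nat_mul _ _
    _ ≤ _ := by gcongr

end Numerics

/-! ### Small volume of the stuck region. -/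

section StuckRegion

variable {d : ℕ} {f : Vec d → ℝ} {σ k ρ χ c : ℝ}

/-- The momentum is unchanged, and r is so small that both εr and ℓr²/2 are at most 𝓔/4. -/
theorem pairEnergy_perturbed_le (hf : IsSmoothWith (σ * k ^ 2) f) (hρ : 0 < ρ) (hσ : 0 < σ)
    (hk : 1 ≤ k) (hχ : 1 ≤ χ) (hc : 48 ≤ c) {x v u : Vec d}
    (hx : ‖gradient f x‖ ≤ (normalizedParams σ k ρ χ c).ε)
    (hu : ‖u‖ ≤ (normalizedParams σ k ρ χ c).r) (η : ℝ) :
    pairEnergy f η (x + u, v) ≤ pairEnergy f η (x, v) + normalizedEnergyUnit σ ρ χ c := by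
  have hk0 : 0 < k := by linarith
  have h1 := hf.le_quadratic x u
  have h2 := (real_inner_le_norm (gradient f x) u).trans
    (mul_le_mul hx hu (norm_nonneg _) ((norm_nonneg _).trans hx))
  have h3 : σ * k ^ 2 / 2 * ‖u‖ ^ 2 ≤ σ * k ^ 2 / 2 * (normalizedParams σ k ρ χ c).r ^ 2 := by
    gcongr
  have hE := normalizedEnergyUnit_nonneg (ρ := ρ) hσ hχ (by linarith : 4 ≤ c)
  have hk2 : 1 ≤ k ^ 2 := one_le_pow₀ hk
  have h4 : (normalizedParams σ k ρ χ c).ε * (normalizedParams σ k ρ χ c).r ≤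
      normalizedEnergyUnit σ ρ χ c / 4 := by
    have : (normalizedParams σ k ρ χ c).ε * (normalizedParams σ k ρ χ c).r =
        normalizedEnergyUnit σ ρ χ c / (4 * (k ^ 2 * c)) := by
      simp only [normalizedParams, normalizedEnergyUnit]; field_simp
    rw [this]
    exact div_le_div_of_nonneg_left hE (by norm_num) (by nlinarith)
  have h5 : σ * k ^ 2 / 2 * (normalizedParams σ k ρ χ c).r ^ 2 ≤
      normalizedEnergyUnit σ ρ χ c / 4 := by
    have : σ * k ^ 2 / 2 * (normalizedParams σ k ρ χ c).r ^ 2 =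
        normalizedEnergyUnit σ ρ χ c / (32 * (k ^ 2 * (χ ^ 5 * c ^ 9))) := by
      simp only [normalizedParams, normalizedEnergyUnit]; field_simp; norm_num
    rw [this]
    have h6 : 1 ≤ k ^ 2 * (χ ^ 5 * c ^ 9) := one_le_mul_of_one_le_of_one_le hk2
      (one_le_mul_of_one_le_of_one_le (one_le_pow₀ hχ) (one_le_pow₀ (by linarith)))
    exact div_le_div_of_nonneg_left hE (by norm_num) (by linarith)
  simp only [pairEnergy]
  linarith

/-- The perturbations from which the Hamiltonian does not decrease by the energy unit have small
probability. -/
theorem cond_volume_stuck_le (hf : IsSmoothWith (σ * k ^ 2) f) (hf' : IsHessianLipschitzWith ρ f)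
    (hρ : 0 < ρ) (hσ : 0 < σ) (hk : 1 ≤ k) (hχ : 1 ≤ χ) (hc : 48 ≤ c)
    (hnum : 2048 * χ ^ 8 * c ^ 12 * Real.exp χ < Real.exp (χ * c / 16)) {δ Δf : ℝ} (hδ : 0 < δ)
    (hΔ : 0 < Δf) (hlog : Real.log (d * (σ * k ^ 2) * Δf / ((σ ^ 2 / ρ) ^ 2 * δ)) ≤ χ)
    {x v : Vec d} (hx : ‖gradient f x‖ ≤ (normalizedParams σ k ρ χ c).ε)
    (hH : minEigenvalue (hessian f x) < -σ) :
    ProbabilityTheory.cond volume (Metric.closedBall (0 : Vec d) (normalizedParams σ k ρ χ c).r)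
      {u | pairEnergy f (normalizedParams σ k ρ χ c).η (x, v) - normalizedEnergyUnit σ ρ χ c
        < pairEnergy f (normalizedParams σ k ρ χ c).η
          (pagdOrbit f (normalizedParams σ k ρ χ c) (x + u, v)
            ⌊(normalizedParams σ k ρ χ c).T⌋₊)}
      ≤ ENNReal.ofReal (δ * normalizedEnergyUnit σ ρ χ c / (2 * Δf)) := by
  have hk0 : 0 < k := by linarith
  have hE : 0 < normalizedEnergyUnit σ ρ χ c := by rw [normalizedEnergyUnit]; positivity
  set q := δ * normalizedEnergyUnit σ ρ χ c / (2 * Δf) with hq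
  have hq0 : 0 < q := by positivity
  obtain ⟨e, eig, i₀, he, hmin, hi₀⟩ :=
    exists_minimal_eigenbasis (hf'.hessian_symmetric x) (by linarith) hH
  have hd : 0 < d := i₀.pos
  have hd' : (0 : ℝ) < d := by exact_mod_cast hd
  have hr0 : 0 < (normalizedParams σ k ρ χ c).r := by
    simp only [normalizedParams]; positivity
  have hTk : (normalizedParams σ k ρ χ c).T = k * χ * c := rfl
  have hrk : (normalizedParams σ k ρ χ c).r = σ / (4 * ρ * k ^ 2 * (χ ^ 5 * c ^ 8)) := rfl
  set p := normalizedParams σ k ρ χ c with hp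
  obtain ⟨N, hN⟩ : ∃ N, ⌊p.T⌋₊ = N + 1 := by
    refine Nat.exists_eq_succ_of_ne_zero (Nat.floor_pos.2 ?_).ne'
    rw [hTk]
    exact one_le_mul_of_one_le_of_one_le (one_le_mul_of_one_le_of_one_le hk hχ) (by linarith)
  set B := Metric.closedBall (0 : Vec d) p.r with hB
  have hB0 : volume B ≠ 0 := (Metric.measure_closedBall_pos _ _ hr0).ne'
  have hBtop : volume B ≠ ⊤ := measure_closedBall_lt_top.ne
  have : IsProbabilityMeasure (ProbabilityTheory.cond volume B) := cond_isProbabilityMeasure_of_finite hB0 hBtop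
  rcases le_or_gt 1 q with hq1 | hq1
  · exact prob_le_one.trans (by rwa [ENNReal.one_le_ofReal])
  set X := {u | pairEnergy f p.η (x, v) - normalizedEnergyUnit σ ρ χ c <
    pairEnergy f p.η (pagdOrbit f p (x + u, v) ⌊p.T⌋₊)} with hX
  have hXm : MeasurableSet X := by
    have h1 : Measurable fun u : Vec d => pagdOrbit f p (x + u, v) ⌊p.T⌋₊ :=
      (measurable_pagdOrbit hf.1.continuous (hf.continuous_gradient (by positivity)) _).comp
        ((measurable_const.add measurable_id).prodMk measurable_const)
    exact measurableSet_lt measurable_const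
      ((measurable_pairEnergy hf.1.continuous _).comp h1)
  -- Chosen so that 3/(K + 1) ≤ q; the case q < 1 also gives K ≤ 4/q, which keeps the spacing r/(dK)
  -- from being too small.
  set K := ⌈3 / q⌉₊ with hK
  have hK0 : 0 < K := Nat.ceil_pos.2 (by positivity)
  have hK3 : 3 / q ≤ K := Nat.le_ceil _
  have hK4 : (K : ℝ) ≤ 4 / q := by
    have h1 := (Nat.ceil_lt_add_one (by positivity : 0 ≤ 3 / q)).le
    have h2 : 1 ≤ 1 / q := (one_le_div hq0).2 hq1.le
    have h3 : 4 / q = 3 / q + 1 / q := by ring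
    linarith
  have hline : ∀ u ∈ B ∩ X, ∀ u' ∈ B ∩ X, ∀ ζ : ℝ, 0 ≤ ζ → u - u' = ζ • e i₀ →
      ζ < p.r / (d * K) := by
    rintro u ⟨hu, huX⟩ u' ⟨hu', huX'⟩ ζ hζ huζ
    rw [hB, mem_closedBall_zero_iff] at hu hu'
    rw [hX, Set.mem_ofPred_eq, hN] at huX huX'
    by_contra! hge
    have h1 := pairEnergy_perturbed_le (v := v) hf hρ hσ hk hχ hc hx hu p.η
    have h2 := pairEnergy_perturbed_le (v := v) hf hρ hσ hk hχ hc hx hu' p.η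
    have h3 := norm_sub_le_of_energy_gt hf hf' hρ hσ hk hχ hc
      (by rw [← hN]; exact Nat.floor_le (by rw [hTk]; positivity)) hu hu' e eig i₀ he hmin hi₀.le
      hζ huζ (by linarith) (by linarith)
    have h4 := exp_le_one_add_pow_floor hk hχ hc
    rw [← hTk, hN] at h4
    -- The logarithmic lower bound on χ bounds q from below; its factor d cancels the d in r/(dK).
    have h5 : d * k ^ 2 * Real.exp (-χ) / (2 * (χ ^ 5 * c ^ 7)) ≤ q := by
      have h6 : d * (σ * k ^ 2) * Δf / ((σ ^ 2 / ρ) ^ 2 * δ) ≤ Real.exp χ :=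
        (Real.log_le_iff_le_exp (by positivity)).1 hlog
      rw [div_le_iff₀ (by positivity)] at h6
      have h7 : d * k ^ 2 * Real.exp (-χ) ≤ σ ^ 3 / ρ ^ 2 * δ / Δf := by
        rw [Real.exp_neg, ← div_eq_mul_inv, div_le_div_iff₀ (Real.exp_pos _) hΔ]
        have h8 : d * k ^ 2 * Δf * σ ≤ σ ^ 3 / ρ ^ 2 * δ * Real.exp χ * σ := by
          refine le_trans (le_of_eq (by ring)) (h6.trans (le_of_eq ?_))
          field_simp
        exact le_of_mul_le_mul_right h8 hσ
      have h8 : q = σ ^ 3 / ρ ^ 2 * δ / Δf / (2 * (χ ^ 5 * c ^ 7)) := by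
        rw [hq, normalizedEnergyUnit]; field_simp
      rw [h8]
      gcongr
    have h6 : p.r * (k ^ 2 * Real.exp (-χ) / (8 * (χ ^ 5 * c ^ 7))) ≤ ζ := by
      refine le_trans ?_ hge
      have h7 : p.r / (d * (4 / q)) ≤ p.r / (d * K) := by gcongr
      refine le_trans ?_ h7
      have h8 : p.r / (d * (4 / q)) = p.r * (q / (4 * d)) := by field_simp
      rw [h8]
      refine mul_le_mul_of_nonneg_left ?_ hr0.le
      rw [le_div_iff₀ (by positivity)]
      refine le_trans (le_of_eq ?_) h5
      field_simp
      norm_num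
    -- Growth starting from the spacing would have to stay below the localization radius; the ratio
    -- of the two sides is exactly the quotient that `hnum` makes larger than 1.
    have h7 : Real.exp (χ * c / 16) / 8 * (p.r * (k ^ 2 * Real.exp (-χ) / (8 * (χ ^ 5 * c ^ 7))))
        ≤ 8 * σ / (ρ * χ ^ 2 * c ^ 3) :=
      le_trans (by gcongr) h3
    have h8 : Real.exp (χ * c / 16) / 8 *
        (p.r * (k ^ 2 * Real.exp (-χ) / (8 * (χ ^ 5 * c ^ 7)))) =
        Real.exp (χ * c / 16) / (2048 * χ ^ 8 * c ^ 12 * Real.exp χ) *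
          (8 * σ / (ρ * χ ^ 2 * c ^ 3)) := by
      rw [hrk, Real.exp_neg]
      field_simp
      norm_num
    rw [h8] at h7
    have h9 : 1 < Real.exp (χ * c / 16) / (2048 * χ ^ 8 * c ^ 12 * Real.exp χ) :=
      (one_lt_div (by positivity)).2 hnum
    have h10 : 0 < 8 * σ / (ρ * χ ^ 2 * c ^ 3) := by positivity
    nlinarith
  have hvol := volume_le_of_line_diameter_lt hd (Metric.isClosed_closedBall.measurableSet.inter hXm)
    hr0 Set.inter_subset_left (e.norm_eq_one i₀) hK0 hline
  rw [cond_apply Metric.isClosed_closedBall.measurableSet, mul_comm, ← div_eq_mul_inv]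
  refine ENNReal.div_le_of_le_mul ?_
  have hKq : (3 : ENNReal) ≤ ENNReal.ofReal q * (K + 1) := by
    have h1 : ((K : ENNReal) + 1) = ENNReal.ofReal (K + 1) := by
      rw [ENNReal.ofReal_add (by positivity) zero_le_one]; simp
    rw [h1, ← ENNReal.ofReal_mul hq0.le, ← ENNReal.ofReal_ofNat 3]
    refine ENNReal.ofReal_le_ofReal ?_
    rw [div_le_iff₀ hq0] at hK3
    nlinarith
  have hK1 : ((K : ENNReal) + 1) ≠ 0 := by simp
  have hK2 : ((K : ENNReal) + 1) ≠ ⊤ := by finiteness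
  refine (ENNReal.mul_le_mul_iff_right hK1 hK2).1 (hvol.trans ?_)
  calc 3 * volume B ≤ ENNReal.ofReal q * (K + 1) * volume B := by gcongr
    _ = (K + 1) * (ENNReal.ofReal q * volume B) := by ring

end StuckRegion

/-! ### From a bound at each fixed past to a conditional probability. -/

section Conditional

/-- A lower bound for a conditional probability given `Y`, from one for the values of an independent
random variable `Z`. -/
theorem le_condProb_of_indepFun {Ω α β : Type*} [MeasurableSpace Ω] [mα : MeasurableSpace α]
    [MeasurableSpace β] {P : Measure Ω} [IsProbabilityMeasure P] {Y : Ω → α} {Z : Ω → β}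
    (hY : Measurable Y) (hZ : Measurable Z) (hYZ : IndepFun Y Z P) {A : Set Ω}
    (hA : MeasurableSet A) {K : Set α} (hK : MeasurableSet K) {W : Set (α × β)}
    (hW : MeasurableSet W) (hWA : ∀ ω, Y ω ∈ K → (Y ω, Z ω) ∉ W → ω ∈ A) {q : ℝ} (hq : 0 ≤ q)
    (hKW : ∀ y ∈ K, P.map Z {z | (y, z) ∈ W} ≤ ENNReal.ofReal q) :
    ∀ᵐ ω ∂P, Y ω ∈ K → 1 - q ≤ (P⟦A | MeasurableSpace.comap Y mα⟧) ω := by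
  have hm := hY.comap_le
  set g := P⟦A | MeasurableSpace.comap Y mα⟧ with hg
  have hgm : StronglyMeasurable[MeasurableSpace.comap Y mα] g := stronglyMeasurable_condExp
  have hlt : MeasurableSet[MeasurableSpace.comap Y mα] {ω | g ω < 1 - q} :=
    hgm.measurable measurableSet_Iio
  obtain ⟨K₁, hK₁, hK₁g⟩ := hlt
  set B := Y ⁻¹' (K ∩ K₁) with hB
  have hBm' : MeasurableSet[MeasurableSpace.comap Y mα] B := ⟨_, hK.inter hK₁, rfl⟩
  have hBm : MeasurableSet B := hm _ hBm'
  -- On the event B of good pasts where the claim fails, Fubini for the product law of (Y, Z) bounds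
  -- the part outside A. Hence 1 - q - g has nonpositive integral over B while being positive there,
  -- so B is null.
  have hbad : P (B \ A) ≤ ENNReal.ofReal q * P B := by
    have h1 : B \ A ⊆ (fun ω => (Y ω, Z ω)) ⁻¹' (W ∩ (K ∩ K₁) ×ˢ Set.univ) := by
      rintro ω ⟨hωB, hωA⟩
      exact ⟨by_contra fun h => hωA (hWA ω hωB.1 h), hωB, trivial⟩
    refine (measure_mono h1).trans ?_
    rw [← Measure.map_apply (hY.prodMk hZ) (hW.inter ((hK.inter hK₁).prod .univ)),
      (indepFun_iff_map_prod_eq_prod_map_map hY.aemeasurable hZ.aemeasurable).1 hYZ]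
    have : IsProbabilityMeasure (P.map Z) := Measure.isProbabilityMeasure_map hZ.aemeasurable
    rw [Measure.prod_apply (hW.inter ((hK.inter hK₁).prod .univ))]
    calc ∫⁻ y, P.map Z (Prod.mk y ⁻¹' (W ∩ (K ∩ K₁) ×ˢ Set.univ)) ∂(P.map Y)
        ≤ ∫⁻ y, (K ∩ K₁).indicator (fun _ => ENNReal.ofReal q) y ∂(P.map Y) := by
          refine lintegral_mono fun y => ?_
          by_cases hy : y ∈ K ∩ K₁
          · rw [Set.indicator_of_mem hy]
            exact (measure_mono fun z hz => hz.1).trans (hKW y hy.1)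
          · have : Prod.mk y ⁻¹' (W ∩ (K ∩ K₁) ×ˢ Set.univ) = ∅ := by
              ext z
              simpa using fun _ h1 h2 => hy ⟨h1, h2⟩
            rw [this]
            simp
      _ = ENNReal.ofReal q * P B := by
          rw [lintegral_indicator_const (hK.inter hK₁), Measure.map_apply hY (hK.inter hK₁)]
  have hreal : (1 - q) * P.real B ≤ P.real (B ∩ A) := by
    have h1 : P.real (B \ A) ≤ q * P.real B := by
      have := ENNReal.toReal_mono (by finiteness) hbad
      rwa [ENNReal.toReal_mul, ENNReal.toReal_ofReal hq] at this
    have h2 := measureReal_inter_add_sdiff (μ := P) (s := B) hA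
    linarith
  have hint : ∫ ω in B, g ω ∂P = P.real (B ∩ A) := by
    rw [hg, setIntegral_condExp hm ((integrable_const (1 : ℝ)).indicator hA) hBm',
      setIntegral_indicator hA]
    simp
  have hgi : Integrable g P := integrable_condExp
  have hdiff : ∫ ω in B, (1 - q - g ω) ∂P ≤ 0 := by
    rw [integral_sub (integrable_const _) hgi.integrableOn, hint]
    simp
    linarith
  have hpos : ∀ ω ∈ B, 0 < 1 - q - g ω := fun ω hω => by
    have : ω ∈ {ω | g ω < 1 - q} := hK₁g ▸ hω.2
    have := Set.mem_ofPred_eq ▸ this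
    linarith
  have hnn : 0 ≤ᵐ[P.restrict B] fun ω => 1 - q - g ω :=
    (ae_restrict_iff' hBm).2 (Filter.Eventually.of_forall fun ω hω => (hpos ω hω).le)
  have hzero := (setIntegral_eq_zero_iff_of_nonneg_ae hnn
    ((integrable_const _).sub hgi).integrableOn).1
    (le_antisymm hdiff (integral_nonneg_of_ae hnn))
  filter_upwards [(ae_restrict_iff' hBm).1 hzero] with ω hω hK
  by_contra! hlt
  have hωB : ω ∈ B := ⟨hK, by
    have : ω ∈ Y ⁻¹' K₁ := by rw [hK₁g]; exact hlt
    exact this⟩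
  exact (hpos ω hωB).ne' (hω hωB)

end Conditional

/-! ### Application to the past samples and the current one. -/

section Final

/-- Extension of a finite sequence of samples by zeros. -/
def extendSamples {d t : ℕ} (y : Fin t → Vec d) (τ : ℕ) : Vec d :=
  if h : τ < t then y ⟨τ, h⟩ else 0

theorem measurable_extendSamples {d t : ℕ} : Measurable (extendSamples (d := d) (t := t)) := by
  refine measurable_pi_lambda _ fun τ => ?_
  unfold extendSamples
  split_ifs with h
  · exact measurable_pi_apply _
  · exact measurable_const

theorem indepFun_past {d : ℕ} {Ω : Type*} [MeasurableSpace Ω] {P : Measure Ω}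
    {ξ : ℕ → Ω → Vec d} (hm : ∀ t, Measurable (ξ t)) (hξ : iIndepFun ξ P) (t : ℕ) :
    IndepFun (fun ω (τ : Fin t) => ξ τ ω) (ξ t) P := by
  have h := hξ.indepFun_finset (Finset.range t) {t} (by simp) hm
  have h1 : Measurable fun (g : Finset.range t → Vec d) (τ : Fin t) =>
      g ⟨τ, Finset.mem_range.2 τ.2⟩ :=
    measurable_pi_lambda _ fun τ => measurable_pi_apply _
  have h2 : Measurable fun (g : ({t} : Finset ℕ) → Vec d) => g ⟨t, Finset.mem_singleton_self t⟩ :=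
    measurable_pi_apply _
  exact h.comp h1 h2

/-- The conditional form of the decrease of the Hamiltonian, for samples whose stuck regions are
small at every state under consideration. -/
theorem le_condProb_hamiltonian {d : ℕ} {f : Vec d → ℝ} {p : PAGDParams} (hf : Continuous f)
    (hg : Continuous (gradient f)) (x₀ : Vec d) (hT : 1 ≤ p.T) {E q : ℝ} (hq : 0 ≤ q)
    {Ω : Type*} [MeasurableSpace Ω] {P : Measure Ω} [IsProbabilityMeasure P]
    {ξ : ℕ → Ω → Vec d} (hm : ∀ t, Measurable (ξ t)) (hξ : iIndepFun ξ P) (t : ℕ) :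
    ∀ᵐ ω ∂P, PerturbCondition f p t (pagd f p x₀ (fun τ => ξ τ ω) t) →
      P.map (ξ t) {u | pairEnergy f p.η ((pagd f p x₀ (fun τ => ξ τ ω) t).x,
            (pagd f p x₀ (fun τ => ξ τ ω) t).v) - E <
          pairEnergy f p.η (pagdOrbit f p ((pagd f p x₀ (fun τ => ξ τ ω) t).x + u,
            (pagd f p x₀ (fun τ => ξ τ ω) t).v) ⌊p.T⌋₊)} ≤ ENNReal.ofReal q →
      1 - q ≤ (P⟦{ω' | hamiltonian f p.η (pagd f p x₀ (fun τ => ξ τ ω') (t + ⌊p.T⌋₊))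
          - hamiltonian f p.η (pagd f p x₀ (fun τ => ξ τ ω') t) ≤ - E}
        | MeasurableSpace.comap (fun ω' (τ : Fin t) => ξ τ ω') inferInstance⟧) ω := by
  obtain ⟨N, hN⟩ : ∃ N, ⌊p.T⌋₊ = N + 1 :=
    Nat.exists_eq_succ_of_ne_zero (Nat.floor_pos.2 hT).ne'
  set S : (Fin t → Vec d) → PAGDState d := fun y => pagd f p x₀ (extendSamples y) t with hS
  obtain ⟨hx, hv, hp⟩ := measurable_pagd (p := p) hf hg x₀ t
  have hSx : Measurable fun y => (S y).x := hx.comp measurable_extendSamples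
  have hSv : Measurable fun y => (S y).v := hv.comp measurable_extendSamples
  have hSp : Measurable[_, ⊤] fun y => (S y).perturbed := by
    let _ : MeasurableSpace (Finset ℕ) := ⊤
    exact hp.comp measurable_extendSamples
  have hSξ : ∀ ω, pagd f p x₀ (fun τ => ξ τ ω) t = S fun τ => ξ τ ω := fun ω =>
    pagd_congr x₀ fun τ hτ => by simp [extendSamples, hτ]
  have hξm : Measurable fun ω (τ : ℕ) => ξ τ ω := measurable_pi_lambda _ hm
  have hpair := measurable_pairEnergy hf p.η
  set W : Set ((Fin t → Vec d) × Vec d) := {z | pairEnergy f p.η ((S z.1).x, (S z.1).v) - E <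
    pairEnergy f p.η (pagdOrbit f p ((S z.1).x + z.2, (S z.1).v) ⌊p.T⌋₊)} with hW
  have hWm : MeasurableSet W := by
    have h1 : Measurable fun z : (Fin t → Vec d) × Vec d => ((S z.1).x, (S z.1).v) :=
      (hSx.comp measurable_fst).prodMk (hSv.comp measurable_fst)
    have h2 : Measurable fun z : (Fin t → Vec d) × Vec d => ((S z.1).x + z.2, (S z.1).v) :=
      ((hSx.comp measurable_fst).add measurable_snd).prodMk (hSv.comp measurable_fst)
    exact measurableSet_lt ((hpair.comp h1).sub_const _)
      (hpair.comp ((measurable_pagdOrbit hf hg _).comp h2))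
  -- The smallness of the stuck region is made part of the condition on the past; it is measurable
  -- because measures of sections of W depend measurably on the base point.
  have hKm : MeasurableSet {y | PerturbCondition f p t (S y) ∧
      P.map (ξ t) {u | (y, u) ∈ W} ≤ ENNReal.ofReal q} :=
    (measurableSet_perturbCondition hg t hSx hSp).inter
      (measurableSet_le (measurable_measure_prodMk_left hWm) measurable_const)
  have hham : ∀ j, Measurable fun ω => hamiltonian f p.η (pagd f p x₀ (fun τ => ξ τ ω) j) := by
    intro j
    obtain ⟨hx, hv, -⟩ := measurable_pagd (p := p) hf hg x₀ j
    exact hpair.comp ((hx.comp hξm).prodMk (hv.comp hξm))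
  have hA : MeasurableSet {ω' | hamiltonian f p.η (pagd f p x₀ (fun τ => ξ τ ω') (t + ⌊p.T⌋₊))
      - hamiltonian f p.η (pagd f p x₀ (fun τ => ξ τ ω') t) ≤ - E} :=
    measurableSet_le ((hham _).sub (hham _)) measurable_const
  have key := le_condProb_of_indepFun (measurable_pi_lambda _ fun τ : Fin t => hm τ) (hm t)
    (indepFun_past hm hξ t) hA hKm hWm (fun ω hω hωW => ?_) hq fun y hy => hy.2
  · filter_upwards [key] with ω hω h1 h2
    rw [hSξ] at h1 h2
    exact hω ⟨h1, h2⟩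
  · have h1 := hω.1
    rw [← hSξ] at h1
    have h2 := (pagd_add_eq_pagdOrbit x₀ (fun τ => ξ τ ω) h1 (n := N)
      (by rw [← hN]; exact Nat.floor_le (by linarith))).1
    rw [← hN, hSξ] at h2
    rw [hW, Set.mem_ofPred_eq, not_lt, ← h2] at hωW
    rw [Set.mem_ofPred_eq, hSξ]
    simp only [pairEnergy] at hωW
    simp only [hamiltonian]
    linarith

end Final

/-- Conditionally on the samples of the iterations before `t`, if at iteration `t` the gradient is
small, the Hessian has a large negative eigenvalue and no perturbation was added recently, then the
Hamiltonian decreases by `𝓔` within `𝒯` iterations with probability at least `1 - δ𝓔/(2Δ_f)`. -/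
theorem lemma4p7 :
    ∃ c_max : ℝ, 0 < c_max ∧
      ∀ (d : ℕ) (f : Vec d → ℝ) (ℓ ρ ε δ Δf χ c : ℝ) (x₀ : Vec d),
        0 < ℓ → 0 < ρ → 0 < ε → 0 < δ → 0 < Δf →
        IsSmoothWith ℓ f → IsHessianLipschitzWith ρ f →
        ε ≤ ℓ ^ 2 / ρ →
        BddBelow (Set.range f) → f x₀ - (⨅ x, f x) ≤ Δf →
        max 1 (Real.log (d * ℓ * Δf / (ε ^ 2 * δ))) ≤ χ →
        c_max ≤ c →
        ∀ (Ω : Type*) [MeasurableSpace Ω] (P : Measure Ω) [IsProbabilityMeasure P]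
          (ξ : ℕ → Ω → Vec d),
          (∀ t, Measurable (ξ t)) → iIndepFun ξ P →
          (∀ t, pdf.IsUniform (ξ t) (Metric.closedBall 0 (pagdParams ℓ ρ ε χ c).r) P volume) →
          ∀ t : ℕ, ∀ᵐ ω ∂P,
            ‖gradient f (pagd f (pagdParams ℓ ρ ε χ c) x₀ (fun τ => ξ τ ω) t).x‖ ≤ ε →
            minEigenvalue
              (hessian f (pagd f (pagdParams ℓ ρ ε χ c) x₀ (fun τ => ξ τ ω) t).x)
                < - √(ρ * ε) →
            NoRecentPerturbation (pagdParams ℓ ρ ε χ c).T t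
              (pagd f (pagdParams ℓ ρ ε χ c) x₀ (fun τ => ξ τ ω) t) →
            1 - δ * energyUnit ρ ε χ c / (2 * Δf) ≤
              (P⟦{ω' | hamiltonian f (pagdParams ℓ ρ ε χ c).η
                      (pagd f (pagdParams ℓ ρ ε χ c) x₀ (fun τ => ξ τ ω')
                        (t + ⌊(pagdParams ℓ ρ ε χ c).T⌋₊))
                    - hamiltonian f (pagdParams ℓ ρ ε χ c).η
                      (pagd f (pagdParams ℓ ρ ε χ c) x₀ (fun τ => ξ τ ω') t)
                    ≤ - energyUnit ρ ε χ c}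
                | MeasurableSpace.comap (fun ω' (τ : Fin t) => ξ τ ω') inferInstance⟧) ω := by
  obtain ⟨C, hC, hnum⟩ := exists_exp_dominates
  refine ⟨C, by linarith, fun d f ℓ ρ ε δ Δf χ c x₀ hℓ hρ hε hδ hΔ hf hf' hεℓ _ _ hχ hc Ω _ P _ ξ
    hm hξ hunif t => ?_⟩
  have hχ1 : 1 ≤ χ := (le_max_left _ _).trans hχ
  have hlog := (le_max_right _ _).trans hχ
  have hc48 : 48 ≤ c := hC.trans hc
  obtain ⟨σ, k, hσ, hk, rfl, hσε, rfl, hE, hpar⟩ :=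
    exists_pagdParams_eq_normalizedParams hℓ hρ hε hεℓ χ c
  rw [hpar] at hunif ⊢
  rw [hE, hσε]
  have hT : 1 ≤ (normalizedParams σ k ρ χ c).T :=
    one_le_mul_of_one_le_of_one_le (one_le_mul_of_one_le_of_one_le hk hχ1) (by linarith)
  have hE0 := normalizedEnergyUnit_nonneg (ρ := ρ) hσ hχ1 (by linarith : 4 ≤ c)
  filter_upwards [le_condProb_hamiltonian (p := normalizedParams σ k ρ χ c) hf.1.continuous
    (hf.continuous_gradient hℓ.le) x₀ hT (E := normalizedEnergyUnit σ ρ χ c)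
    (q := δ * normalizedEnergyUnit σ ρ χ c / (2 * Δf)) (by positivity) hm hξ t] with ω hω hgrad hH hno
  refine hω ⟨hgrad, hno⟩ ?_
  rw [hunif t]
  exact cond_volume_stuck_le hf hf' hρ hσ hk hχ1 hc48 (hnum c hc χ hχ1) hδ hΔ hlog hgrad hH
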